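/- Fix $n\ge 1$ and write $[n]=\{1,\dots,n\}$. A partition is $\lambda=(\lambda_1\ge\dots\ge\lambda_n\ge 0)$; $\mathcal T_\lambda$ is the set of semistandard tableaux of shape $\lambda$ with values in $[n]$, ordered by entrywise comparison, and $x^{\Theta(T)}=\prod_{k}x_k^{\#\{\text{boxes of }T\text{ with value }k\}}$. Let $R_\lambda=\{q_1<\dots<q_r\}$ be the set of column lengths of $\lambda$ that are less than $n$, and put $q_0=0$, $q_{r+1}=n$; the intervals $(q_{h-1},q_h]$, $1\le h\le r+1$, are the carrels. A tuple $\upsilon\in[n]^n$ is upper if $\upsilon_i\ge i$ for all $i$, is a flag if it is weakly increasing, and is $\lambda$-increasing if it is strictly increasing on each carrel. A $\lambda$-permutation is a $\lambda$-increasing permutation $\pi$ of $[n]$; it is $\lambda$-312-avoiding if there are no $h$ and $a\le q_h<b\le q_{h+1}<c$ with $\pi_b<\pi_c<\pi_a$. * For an upper tuple $\beta$, $\mathcal S_\lambda(\beta)$ is the set of $T\in\mathcal T_\lambda$ all of whose values in row $i$ are at most $\beta_i$ ($i\in[n]$); the row bound sum is $s_\lambda(\beta;x)=\sum_{T\in\mathcal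 S_\lambda(\beta)}x^{\Theta(T)}$, called a flag Schur polynomial if $\beta$ is also a flag. $Q_\lambda(\beta)$ is the least upper bound of $\mathcal S_\lambda(\beta)$ in $\mathcal T_\lambda$. * For a $\lambda$-permutation $\pi$, the key $Y_\lambda(\pi)$ is the tableau of shape $\lambda$ in which every column of length $q$ has the set of values $\{\pi_1,\dots,\pi_q\}$. The rank tuple $\Psi_\lambda(\pi)$ has, for $i\in(q_{h-1},q_h]$, the $i$-th smallest element of $\{\pi_1,\dots,\pi_{q_h}\}$ as its $i$-th entry. $\mathcal D_\lambda(\pi)$ is the set of $T\in\mathcal T_\lambda$ whose scanning tableau (right key) $S(T)$ satisfies $S(T)\le Y_\lambda(\pi)$, and the Demazure polynomial is $d_\lambda(\pi;x)=\sum_{T\in\mathcal D_\lambda(\pi)}x^{\Theta(T)}$. Here column $j$ of $S(T)$ is filled from bottom to top by repeating the following: read the bottom values of columns $j,j+1,\dots$ of what is left of $T$, take the greedy (earliest) weakly increasing subsequence that starts at column $j$, record its last value, and delete the boxes used; for the next $j$ start again from the full columns of $T$. * The critical indices of an upper tuple $\upsilon$ are found in each carrel from right to left: the last index of the carrel is critical,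 and after a critical index $x$ the next one is the largest index $x'<x$ of the carrel with $\upsilon_x-\upsilon_{x'}>x-x'$, if there is one. With $x$ the smallest critical index $\ge i$, the core $\Delta_\lambda(\upsilon)$ has the entries $\upsilon_x-(x-i)$. An upper $\lambda$-increasing tuple $\gamma$ is gapless if, whenever $1\le h\le r$ and $\gamma_{q_h}>\gamma_{q_h+1}$, for $s=\gamma_{q_h}-\gamma_{q_h+1}+1$ one has $s\le q_{h+1}-q_h$ and the first $s$ entries of the carrel $(q_h,q_{h+1}]$ are $\gamma_{q_h}-s+1,\dots,\gamma_{q_h}$. An upper tuple is a gapless core tuple if its core is gapless. For gapless $\gamma$ the floor $\Phi_\lambda(\gamma)$ has, with $x$ the smallest critical index of $\gamma$ with $x\ge i$, the $i$-th entry $\max\{\gamma_{q_h},\gamma_x-(x-i)\}$ if $i<x$ and $x$ is the leftmost critical index of the carrel $(q_h,q_{h+1}]$ for some $h\ge 1$, and $\gamma_x-(x-i)$ otherwise. **Theorem.** Let $\lambda,\lambda'$ be partitions, let $\beta$ be an upper tuple and let $\pi$ be a $\lambda'$-permutation. Suppose that $s_\lambda(\beta;x)=d_{\lambda'}(\pi;x)$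 as polynomials. Then 1. $\lambda=\lambda'$, $Q_\lambda(\beta)=Y_{\lambda'}(\pi)$ and $\Delta_\lambda(\beta)=\Psi_\lambda(\pi)$; 2. $\pi$ is $\lambda$-312-avoiding, and $\Delta_\lambda(\beta)$ is gapless, so that $\beta$ is a gapless core tuple; 3. $\mathcal S_\lambda(\beta)=\mathcal D_{\lambda'}(\pi)$, i.e. the equality already holds at the level of tableau sets; 4. $\varphi=\Phi_\lambda(\Delta_\lambda(\beta))$ is an upper flag with $\mathcal S_\lambda(\beta)=\mathcal S_\lambda(\varphi)$, so that $s_\lambda(\beta;x)$ is the flag Schur polynomial $s_\lambda(\varphi;x)$. Hence the only row bound sums that arise as Demazure polynomials are flag Schur polynomials. -/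

import Mathlib

/-!
Conventions.  Everything is indexed from `0`: the set `[n] = {1, …, n}` becomes `Fin n`, so the
`k`-th entry (row, value, …) of the usual convention is the one with number `k - 1` here.  Dividers
and column lengths are counts and are not shifted: a divider `q` stands between the first `q`
entries and the remaining ones, i.e. between the positions `q - 1` and `q`.
-/

namespace RowBoundSums

/-! ### Tuples with dividers -/

section Tuples

variable {n : ℕ}

/-- `υ` is an upper tuple: `υ_i ≥ i` for all `i`. -/
def IsUpper (υ : Fin n → Fin n) : Prop := ∀ i, i ≤ υ i

/-- `φ` is a flag: it is weakly increasing. -/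
def IsFlag (φ : Fin n → Fin n) : Prop := Monotone φ

/-- The positions `i` and `k` lie in the same carrel: no divider of `R` separates them. -/
def SameCarrel (R : Finset ℕ) (i k : Fin n) : Prop := ∀ q ∈ R, ((i : ℕ) < q ↔ (k : ℕ) < q)

/-- The divider at the left end of the carrel of the position `i`: the carrel consists of
positions `k` with `carrelStart R i ≤ k`.  It is `0` for the first carrel. -/
def carrelStart (R : Finset ℕ) (i : Fin n) : ℕ := (R.filter (fun q => q ≤ (i : ℕ))).sup id

theorem carrelStart_le (R : Finset ℕ) (i : Fin n) : carrelStart R i ≤ i :=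
  Finset.sup_le fun _ hq => (Finset.mem_filter.1 hq).2

theorem carrelEnd_aux (R : Finset ℕ) (i : Fin n) :
    ((insert n R).filter (fun q => (i : ℕ) < q)).Nonempty :=
  ⟨n, Finset.mem_filter.2 ⟨Finset.mem_insert_self n R, i.isLt⟩⟩

/-- The divider at the right end of the carrel of the position `i` (the last carrel is closed by
the divider `n`): the carrel consists of the positions `k` with
`carrelStart R i ≤ k < carrelEnd R i`. -/
def carrelEnd (R : Finset ℕ) (i : Fin n) : ℕ :=
  ((insert n R).filter (fun q => (i : ℕ) < q)).min' (carrelEnd_aux R i)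

theorem lt_carrelEnd (R : Finset ℕ) (i : Fin n) : (i : ℕ) < carrelEnd R i :=
  (Finset.mem_filter.1 (Finset.min'_mem _ (carrelEnd_aux R i))).2

theorem carrelEnd_le (R : Finset ℕ) (i : Fin n) : carrelEnd R i ≤ n :=
  Finset.min'_le _ _ (Finset.mem_filter.2 ⟨Finset.mem_insert_self n R, i.isLt⟩)

/-- `α` is `R`-increasing: strictly increasing on each carrel. -/
def IsIncreasing (R : Finset ℕ) (α : Fin n → Fin n) : Prop :=
  ∀ i k, SameCarrel R i k → i < k → α i < α k

/-- `π` is an `R`-permutation: a permutation that is `R`-increasing. -/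
def IsRPermutation (R : Finset ℕ) (π : Equiv.Perm (Fin n)) : Prop := IsIncreasing R π

/-- `π` is `R`-312-containing: there are positions `a`, `b`, `c` with
`a ≤ q_h < b ≤ q_{h+1} < c` for two consecutive dividers (in one-based numbering) such that
`π_b < π_c < π_a`. -/
def Contains312 (R : Finset ℕ) (π : Equiv.Perm (Fin n)) : Prop :=
  ∃ a b c : Fin n, (a : ℕ) < carrelStart R b ∧ carrelEnd R b ≤ (c : ℕ) ∧ π b < π c ∧ π c < π a

/-- `π` is `R`-312-avoiding. -/
def Avoids312 (R : Finset ℕ) (π : Equiv.Perm (Fin n)) : Prop := ¬ Contains312 R π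

/-- `γ` is a gapless `R`-tuple: it is upper and `R`-increasing, and whenever it descends across a
divider, from the position `a` to the position `b = a + 1`, then for `s = γ_a - γ_b + 1` the carrel
of `b` has at least `s` positions and the first `s` entries in it are
`γ_a - s + 1, γ_a - s + 2, …, γ_a`. -/
def IsGapless (R : Finset ℕ) (γ : Fin n → Fin n) : Prop :=
  IsUpper γ ∧ IsIncreasing R γ ∧
    ∀ a b : Fin n, (b : ℕ) = a + 1 → (b : ℕ) ∈ R → γ b < γ a →
      ∀ s : ℕ, s = (γ a : ℕ) - γ b + 1 →
        (b : ℕ) + s ≤ carrelEnd R b ∧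
          ∀ c : Fin n, b ≤ c → (c : ℕ) < b + s →
            ((γ c : ℕ) : ℤ) = ((γ a : ℕ) : ℤ) - s + 1 + ((c : ℕ) - (b : ℕ) : ℤ)

/-- The critical indices of `υ`.  The last position of each carrel is critical; and if `x` is
critical, then the largest position `x' < x` in the same carrel with `υ_x - υ_{x'} > x - x'` (if
there is one) is the next critical index to the left. -/
inductive IsCritical (R : Finset ℕ) (υ : Fin n → Fin n) : Fin n → Prop
  | last (x : Fin n) (hx : (x : ℕ) + 1 ∈ R ∨ (x : ℕ) + 1 = n) : IsCritical R υ x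
  | next (x x' : Fin n) (hx : IsCritical R υ x) (hc : SameCarrel R x' x) (hlt : x' < x)
      (hgap : ((υ x : ℕ) : ℤ) - (υ x' : ℕ) > ((x : ℕ) : ℤ) - (x' : ℕ))
      (hmax : ∀ y : Fin n, x' < y → y < x →
        ¬ ((υ x : ℕ) : ℤ) - (υ y : ℕ) > ((x : ℕ) : ℤ) - (y : ℕ)) :
      IsCritical R υ x'

open Classical in
theorem nextCritical_aux (R : Finset ℕ) (υ : Fin n → Fin n) (i : Fin n) :
    (Finset.univ.filter (fun x => IsCritical R υ x ∧ i ≤ x)).Nonempty := by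
  refine ⟨⟨n - 1, by have := i.isLt; omega⟩, Finset.mem_filter.2 ⟨Finset.mem_univ _, ?_, ?_⟩⟩
  · have := i.isLt
    exact IsCritical.last _ (Or.inr (by change n - 1 + 1 = n; omega))
  · have := i.isLt
    change (i : ℕ) ≤ n - 1
    omega

open Classical in
/-- The smallest critical index `x` of `υ` with `i ≤ x`. -/
noncomputable def nextCritical (R : Finset ℕ) (υ : Fin n → Fin n) (i : Fin n) : Fin n :=
  (Finset.univ.filter (fun x => IsCritical R υ x ∧ i ≤ x)).min' (nextCritical_aux R υ i)

/-- The staircase entry `υ_x - (x - i)`, where `x` is the smallest critical index with `i ≤ x`. -/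
noncomputable def staircase (R : Finset ℕ) (υ : Fin n → Fin n) (i : Fin n) : Fin n :=
  ⟨(υ (nextCritical R υ i) : ℕ) - ((nextCritical R υ i : ℕ) - (i : ℕ)),
    lt_of_le_of_lt (Nat.sub_le _ _) (υ (nextCritical R υ i)).isLt⟩

/-- The `R`-core `Δ_R(υ)` of `υ`: the entries of `υ` at its critical indices are kept, and a
staircase is formed toward the left from each critical index. -/
noncomputable def core (R : Finset ℕ) (υ : Fin n → Fin n) : Fin n → Fin n := staircase R υ

/-- `υ` is a gapless core `R`-tuple: an upper tuple whose `R`-core is gapless. -/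
def IsGaplessCore (R : Finset ℕ) (υ : Fin n → Fin n) : Prop :=
  IsUpper υ ∧ IsGapless R (core R υ)

open Classical in
/-- The `R`-floor map `Φ_R`.  The critical entries are kept.  At a non-critical position `i`, with
`x` the next critical index, the entry is `γ_x - (x - i)`, except that it is
`max {γ_{q}, γ_x - (x - i)}`, with `γ_q` the last entry of the preceding carrel, if `x` is the
leftmost critical index of a carrel that is not the first one. -/
noncomputable def floorMap (R : Finset ℕ) (γ : Fin n → Fin n) (i : Fin n) : Fin n :=
  if 0 < carrelStart R i ∧ i < nextCritical R γ i ∧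
      ∀ y : Fin n, SameCarrel R y i → y < nextCritical R γ i → ¬ IsCritical R γ y then
    max (γ ⟨carrelStart R i - 1,
      lt_of_le_of_lt ((Nat.sub_le _ _).trans (carrelStart_le R i)) i.isLt⟩) (staircase R γ i)
  else staircase R γ i

/-- The set `{π_1, …, π_q}` of the first `q` values of `π`. -/
def prefixSet (π : Equiv.Perm (Fin n)) (q : ℕ) : Finset (Fin n) :=
  (Finset.univ.filter (fun k : Fin n => (k : ℕ) < q)).map π.toEmbedding

theorem card_prefixSet (π : Equiv.Perm (Fin n)) {q : ℕ} (hq : q ≤ n) :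
    (prefixSet π q).card = q := by
  rw [prefixSet, Finset.card_map]
  simp [Fin.card_filter_val_lt, hq]

/-- The rank `R`-tuple `Ψ_R(π)`: on the carrel with right end `q` its entries are the largest
values among the first `q` values of `π`, in increasing order.  So the entry at the position `i` is
the `i`-th smallest element of the `q`-element set `{π_1, …, π_q}`, which is its `(q - i + 1)`-st
largest element in one-based numbering. -/
def rankTuple (R : Finset ℕ) (π : Equiv.Perm (Fin n)) (i : Fin n) : Fin n :=
  (prefixSet π (carrelEnd R i)).orderEmbOfFin (card_prefixSet π (carrelEnd_le R i))
    ⟨i, lt_carrelEnd R i⟩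

end Tuples

/-! ### Partitions and tableaux -/

/-- The partitions with at most `n` parts, given by their shapes.  The `i`-th part of `lam` is
`lam.1.rowLen i`; the length of the `j`-th column is `lam.1.colLen j`. -/
abbrev NPartition (n : ℕ) : Type := {μ : YoungDiagram // μ.colLen 0 ≤ n}

section Tableaux

variable {n : ℕ}

/-- The set `R_λ` of the column lengths of `lam` that are less than `n`. -/
def columnLengths (lam : NPartition n) : Finset ℕ :=
  ((Finset.range (lam.1.rowLen 0)).image lam.1.colLen).filter (fun q => q < n)

/-- The set of semistandard tableaux of shape `lam` with values in `[n]`, as a set of fillings: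
`T i j` is the value in the row `i` and the column `j`, and it is `0` outside the shape.  The
pointwise order on fillings is the entrywise comparison of tableaux. -/
def tableaux (lam : NPartition n) : Set (ℕ → ℕ → ℕ) :=
  {f | ∃ T : SemistandardYoungTableau lam.1,
    (T : ℕ → ℕ → ℕ) = f ∧ ∀ i j : ℕ, (i, j) ∈ lam.1 → T i j < n}

theorem tableaux_finite (lam : NPartition n) : (tableaux lam).Finite := by
  have hsub : tableaux lam ⊆ Set.range (fun (g : lam.1.cells → Fin n) (i j : ℕ) =>
      if h : (i, j) ∈ lam.1.cells then ((g ⟨(i, j), h⟩ : Fin n) : ℕ) else 0) := by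
    rintro f ⟨T, rfl, hT⟩
    refine ⟨fun c => ⟨T c.1.1 c.1.2, hT _ _ ((YoungDiagram.mem_cells _).1 c.2)⟩, ?_⟩
    funext i j
    by_cases h : (i, j) ∈ lam.1.cells
    · simp [h]
    · simp only [h, dif_neg, not_false_iff]
      exact (T.zeros (fun h' => h ((YoungDiagram.mem_cells _).2 h'))).symm
  exact (Set.finite_range _).subset hsub

/-- The content of the filling `T` of the shape `lam`: the entry at `k` is the number of boxes that
hold the value `k`. -/
noncomputable def content (lam : NPartition n) (T : ℕ → ℕ → ℕ) : Fin n →₀ ℕ :=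
  Finsupp.equivFunOnFinite.symm
    (fun k : Fin n => (lam.1.cells.filter (fun c => T c.1 c.2 = (k : ℕ))).card)

/-- The generating function `∑ x^{Θ(T)}` of a set `A` of tableaux of shape `lam`. -/
noncomputable def genFun (lam : NPartition n) (A : Set (ℕ → ℕ → ℕ)) (hA : A ⊆ tableaux lam) :
    MvPolynomial (Fin n) ℤ :=
  ∑ T ∈ ((tableaux_finite lam).subset hA).toFinset, MvPolynomial.monomial (content lam T) 1

/-! ### Row bound sums -/

/-- The row bound set `S_λ(β)`: the tableaux whose values in the row `i` are at most `β_i`. -/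
def rowBoundSet (lam : NPartition n) (β : Fin n → Fin n) : Set (ℕ → ℕ → ℕ) :=
  {T | T ∈ tableaux lam ∧ ∀ (i : Fin n) (j : ℕ), ((i : ℕ), j) ∈ lam.1 → T i j ≤ β i}

theorem rowBoundSet_subset (lam : NPartition n) (β : Fin n → Fin n) :
    rowBoundSet lam β ⊆ tableaux lam := fun _ h => h.1

/-- The row bound sum `s_λ(β; x)`.  It is a flag Schur polynomial if `β` is an upper flag. -/
noncomputable def rowBoundSum (lam : NPartition n) (β : Fin n → Fin n) :
    MvPolynomial (Fin n) ℤ :=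
  genFun lam (rowBoundSet lam β) (rowBoundSet_subset lam β)

/-- The row bound max tableau `Q_λ(β)`: the entrywise maximum of the tableaux in `S_λ(β)`.  For an
upper tuple `β` it is their least upper bound in the poset of tableaux of shape `lam`, see
`rowBoundMax_isLeast`. -/
noncomputable def rowBoundMax (lam : NPartition n) (β : Fin n → Fin n) : ℕ → ℕ → ℕ :=
  fun i j => sSup ((fun T : ℕ → ℕ → ℕ => T i j) '' rowBoundSet lam β)

theorem rowBoundMax_isLeast (lam : NPartition n) (β : Fin n → Fin n) (hβ : IsUpper β) :
    IsLeast {U | U ∈ tableaux lam ∧ U ∈ upperBounds (rowBoundSet lam β)} (rowBoundMax lam β) := by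
  have hfin : (rowBoundSet lam β).Finite := (tableaux_finite lam).subset (rowBoundSet_subset lam β)
  have hrow : ∀ i j : ℕ, (i, j) ∈ lam.1 → i < n := by
    intro i j h
    have h0 : (i, 0) ∈ lam.1 := lam.1.up_left_mem le_rfl (Nat.zero_le j) h
    exact lt_of_lt_of_le (YoungDiagram.mem_iff_lt_colLen.1 h0) lam.2
  have hne : (rowBoundSet lam β).Nonempty := by
    refine ⟨SemistandardYoungTableau.highestWeight lam.1, ⟨_, rfl, ?_⟩, ?_⟩
    · intro i j h
      simpa [h] using hrow i j h
    · intro i j h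
      simpa [h] using hβ i
  have hbdd : ∀ i j, BddAbove ((fun T : ℕ → ℕ → ℕ => T i j) '' rowBoundSet lam β) :=
    fun i j => (hfin.image _).bddAbove
  have hatt : ∀ i j, ∃ T ∈ rowBoundSet lam β, T i j = rowBoundMax lam β i j :=
    fun i j => Nat.sSup_mem (hne.image _) (hbdd i j)
  have hub : ∀ T ∈ rowBoundSet lam β, T ≤ rowBoundMax lam β :=
    fun T hT i j => le_csSup (hbdd i j) ⟨T, hT, rfl⟩
  refine ⟨⟨⟨⟨rowBoundMax lam β, ?_, ?_, ?_⟩, rfl, ?_⟩, hub⟩, ?_⟩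
  · intro i j1 j2 hj hc
    obtain ⟨T, hT, hTe⟩ := hatt i j1
    obtain ⟨⟨S, rfl, -⟩, -⟩ := id hT
    rw [← hTe]
    exact (S.row_weak hj hc).trans (hub _ hT i j2)
  · intro i1 i2 j hi hc
    obtain ⟨T, hT, hTe⟩ := hatt i1 j
    obtain ⟨⟨S, rfl, -⟩, -⟩ := id hT
    rw [← hTe]
    exact (S.col_strict hi hc).trans_le (hub _ hT i2 j)
  · intro i j hc
    obtain ⟨T, hT, hTe⟩ := hatt i j
    obtain ⟨⟨S, rfl, -⟩, -⟩ := id hT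
    rw [← hTe]
    exact S.zeros hc
  · intro i j hc
    obtain ⟨T, hT, hTe⟩ := hatt i j
    obtain ⟨⟨S, rfl, hS⟩, -⟩ := id hT
    change rowBoundMax lam β i j < n
    rw [← hTe]
    exact hS i j hc
  · rintro U ⟨-, hU⟩ i j
    obtain ⟨T, hT, hTe⟩ := hatt i j
    rw [← hTe]
    exact hU hT i j

/-! ### Demazure polynomials -/

theorem colLen_le (lam : NPartition n) (j : ℕ) : lam.1.colLen j ≤ n :=
  (lam.1.colLen_anti 0 j (Nat.zero_le j)).trans lam.2

/-- The key `Y_λ(π)`: each column of length `q` holds the first `q` values of `π`, in increasing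
order from top to bottom. -/
def key (lam : NPartition n) (π : Equiv.Perm (Fin n)) : ℕ → ℕ → ℕ := fun i j =>
  if h : i < lam.1.colLen j then
    ((prefixSet π (lam.1.colLen j)).orderEmbOfFin (card_prefixSet π (colLen_le lam j)) ⟨i, h⟩ : ℕ)
  else 0

/-- Auxiliary to `ewis`: continue an earliest weakly increasing subsequence whose last value so far
is `v`. -/
def ewisFrom : ℕ → List (ℕ × ℕ) → List (ℕ × ℕ)
  | _, [] => []
  | v, (k, x) :: l => if v ≤ x then (k, x) :: ewisFrom x l else ewisFrom v l

/-- The earliest weakly increasing subsequence of a sequence of labelled values `(label, value)`: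
it starts with the first value, and each further term is the earliest later value that is at least
the preceding term. -/
def ewis : List (ℕ × ℕ) → List (ℕ × ℕ)
  | [] => []
  | (k, x) :: l => (k, x) :: ewisFrom x l

/-- The bottom values of the nonempty ones among the columns `j, j + 1, …` of `T`, from left to
right and labelled by their columns, when only the top `c k` boxes of each column `k` are left. -/
def bottoms (lam : NPartition n) (T : ℕ → ℕ → ℕ) (j : ℕ) (c : ℕ → ℕ) : List (ℕ × ℕ) :=
  ((List.range' j (lam.1.rowLen 0 - j)).filter (fun k => decide (0 < c k))).map
    (fun k => (k, T (c k - 1) k))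

/-- Mark the boxes of the scanning path, i.e. remove them from the bottoms of their columns. -/
def removePath (lam : NPartition n) (T : ℕ → ℕ → ℕ) (j : ℕ) (c : ℕ → ℕ) : ℕ → ℕ :=
  fun k => if k ∈ (ewis (bottoms lam T j c)).map Prod.fst then c k - 1 else c k

/-- The scanning tableau `S(T)` (the right key of `T`).  Its column `j` is filled from bottom to top:
starting with the columns `j, j + 1, …` of `T`, find the earliest weakly increasing subsequence of
the bottom values, record its final value, mark its boxes, and repeat without the marked boxes.  So
the value in the row `i` is the one recorded after `colLen j - 1 - i` paths have been removed. -/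
def scan (lam : NPartition n) (T : ℕ → ℕ → ℕ) : ℕ → ℕ → ℕ := fun i j =>
  if (i, j) ∈ lam.1 then
    (((ewis (bottoms lam T j
      ((removePath lam T j)^[lam.1.colLen j - 1 - i] lam.1.colLen))).getLast?).map
        Prod.snd).getD 0
  else 0

/-- The set `D_λ(π)` of Demazure tableaux: the tableaux `T` with `S(T) ≤ Y_λ(π)`. -/
def demazureSet (lam : NPartition n) (π : Equiv.Perm (Fin n)) : Set (ℕ → ℕ → ℕ) :=
  {T | T ∈ tableaux lam ∧ scan lam T ≤ key lam π}

theorem demazureSet_subset (lam : NPartition n) (π : Equiv.Perm (Fin n)) :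
    demazureSet lam π ⊆ tableaux lam := fun _ h => h.1

/-- The Demazure polynomial `d_λ(π; x)`. -/
noncomputable def demazurePoly (lam : NPartition n) (π : Equiv.Perm (Fin n)) :
    MvPolynomial (Fin n) ℤ :=
  genFun lam (demazureSet lam π) (demazureSet_subset lam π)

end Tableaux

end RowBoundSums

open RowBoundSums

/-! The polynomial identity is lifted to tableau sets by means of two tableaux that their contents
single out. The superstandard tableau lies in both sets, and its content is dominant: no tableau of
the same shape has more values below `k`. Each shape thus dominates the other, and `lam = lam'`
(`shape_eq_of_genFun_eq`). The key `Y` lies in the Demazure set and is the only tableau of its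
content (`eq_key_of_content_eq`), so it also lies in the row bound set.

The row bound set is closed downward, and each Demazure tableau satisfies `T ≤ S(T) ≤ Y`. Hence the
Demazure set is contained in the row bound set. Setting all variables to 1 shows that they have the
same size, so they coincide, and `Y` is the maximum of both.

The rest is read off from this. Comparing the columns of `Q` and `Y` gives core = rank tuple
(`core_eq_rankTuple`). The Demazure set is now the full interval below `Y`. A 312 pattern would
produce a tableau below `Y` whose scanning tableau is not below `Y`, so `π` avoids it
(`avoids312_of_demazureSet_eq`). Avoidance makes the rank tuple gapless (`isGapless_rankTuple`).
Finally, a row bound set depends only on the critical entries of its bound (`le_of_le_at_critical`).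
The floor keeps these entries, and gaplessness is what makes it a flag
(`IsGapless.isFlag_floorMap`). -/

namespace RowBoundSums

/-! ### Carrels, critical indices and cores -/

section Tuples

variable {n : ℕ}

theorem carrelEnd_eq_or_mem (R : Finset ℕ) (i : Fin n) : carrelEnd R i = n ∨ carrelEnd R i ∈ R := by
  have h := (Finset.mem_filter.1 (Finset.min'_mem _ (carrelEnd_aux R i))).1
  exact Finset.mem_insert.1 h

theorem carrelEnd_le_of_mem {R : Finset ℕ} {i : Fin n} {q : ℕ} (hq : q ∈ R) (h : (i : ℕ) < q) :
    carrelEnd R i ≤ q :=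
  Finset.min'_le _ _ (Finset.mem_filter.2 ⟨Finset.mem_insert_of_mem hq, h⟩)

theorem carrelStart_eq_or_mem (R : Finset ℕ) (i : Fin n) :
    carrelStart R i = 0 ∨ carrelStart R i ∈ R := by
  rcases (R.filter (fun q => q ≤ (i : ℕ))).eq_empty_or_nonempty with h | h
  · left
    simp [carrelStart, h]
  · right
    obtain ⟨q, hq, he⟩ := Finset.exists_mem_eq_sup _ h id
    rw [carrelStart, he]
    exact (Finset.mem_filter.1 hq).1

theorem le_carrelStart {R : Finset ℕ} {i : Fin n} {q : ℕ} (hq : q ∈ R) (h : q ≤ (i : ℕ)) :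
    q ≤ carrelStart R i :=
  Finset.le_sup (f := id) (Finset.mem_filter.2 ⟨hq, h⟩)

theorem SameCarrel.symm {R : Finset ℕ} {i k : Fin n} (h : SameCarrel R i k) : SameCarrel R k i :=
  fun q hq => (h q hq).symm

theorem SameCarrel.trans {R : Finset ℕ} {i k l : Fin n} (h : SameCarrel R i k)
    (h' : SameCarrel R k l) : SameCarrel R i l :=
  fun q hq => (h q hq).trans (h' q hq)

theorem sameCarrel_iff {R : Finset ℕ} {i k : Fin n} (hik : i ≤ k) :
    SameCarrel R i k ↔ (k : ℕ) < carrelEnd R i := by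
  constructor
  · intro h
    rcases carrelEnd_eq_or_mem R i with he | he
    · rw [he]
      exact k.isLt
    · exact (h _ he).1 (lt_carrelEnd R i)
  · intro h q hq
    exact ⟨fun hi => h.trans_le (carrelEnd_le_of_mem hq hi), fun hk => lt_of_le_of_lt hik hk⟩

theorem SameCarrel.of_between {R : Finset ℕ} {i j k : Fin n} (h : SameCarrel R i k) (hij : i ≤ j)
    (hjk : j ≤ k) : SameCarrel R i j :=
  (sameCarrel_iff hij).2 (lt_of_le_of_lt hjk ((sameCarrel_iff (hij.trans hjk)).1 h))

theorem SameCarrel.carrelStart_eq {R : Finset ℕ} {i k : Fin n} (h : SameCarrel R i k) :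
    carrelStart R i = carrelStart R k := by
  have : R.filter (fun q => q ≤ (i : ℕ)) = R.filter (fun q => q ≤ (k : ℕ)) :=
    Finset.filter_congr fun q hq => by rw [← not_lt, ← not_lt, h q hq]
  rw [carrelStart, carrelStart, this]

theorem SameCarrel.carrelEnd_eq {R : Finset ℕ} {i k : Fin n} (h : SameCarrel R i k) :
    carrelEnd R i = carrelEnd R k := by
  have : (insert n R).filter (fun q => (i : ℕ) < q) = (insert n R).filter (fun q => (k : ℕ) < q) :=
    Finset.filter_congr fun q hq => by
      rcases Finset.mem_insert.1 hq with rfl | hq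
      · exact iff_of_true i.isLt k.isLt
      · exact h q hq
  simp only [carrelEnd, this]

/-- Beyond a critical index the excess `υ_y - y` is larger throughout the carrel. -/
theorem IsCritical.lt_of_lt {R : Finset ℕ} {υ : Fin n → Fin n} {x : Fin n}
    (hx : IsCritical R υ x) :
    ∀ y, x < y → SameCarrel R x y → (υ x : ℕ) + y < υ y + x := by
  induction hx with
  | last x hx =>
    intro y hxy hc
    have hy := y.isLt
    have hxy' : (x : ℕ) < y := hxy
    rcases hx with hx | hx
    · have := (hc _ hx).1 (Nat.lt_succ_self _)
      omega
    · omega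
  | next x x' hx hc hlt hgap hmax ih =>
    intro y hxy hcy
    have hxy' : (x' : ℕ) < y := hxy
    rcases lt_trichotomy y x with h | rfl | h
    · have := hmax y hxy h
      omega
    · omega
    · have := ih y h (hc.symm.trans hcy)
      omega

theorem isCritical_nextCritical (R : Finset ℕ) (υ : Fin n → Fin n) (i : Fin n) :
    IsCritical R υ (nextCritical R υ i) := by
  classical
  exact (Finset.mem_filter.1 (Finset.min'_mem _ (nextCritical_aux R υ i))).2.1

theorem le_nextCritical (R : Finset ℕ) (υ : Fin n → Fin n) (i : Fin n) :
    i ≤ nextCritical R υ i := by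
  classical
  exact (Finset.mem_filter.1 (Finset.min'_mem _ (nextCritical_aux R υ i))).2.2

theorem nextCritical_le {R : Finset ℕ} {υ : Fin n → Fin n} {i y : Fin n}
    (hy : IsCritical R υ y) (hiy : i ≤ y) : nextCritical R υ i ≤ y := by
  classical
  exact Finset.min'_le _ _ (Finset.mem_filter.2 ⟨Finset.mem_univ _, hy, hiy⟩)

theorem nextCritical_eq_self {R : Finset ℕ} {υ : Fin n → Fin n} {x : Fin n}
    (hx : IsCritical R υ x) : nextCritical R υ x = x :=
  le_antisymm (nextCritical_le hx le_rfl) (le_nextCritical R υ x)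

theorem nextCritical_eq_of_le {R : Finset ℕ} {υ : Fin n → Fin n} {i k : Fin n} (hik : i ≤ k)
    (hk : k ≤ nextCritical R υ i) : nextCritical R υ k = nextCritical R υ i :=
  le_antisymm (nextCritical_le (isCritical_nextCritical R υ i) hk)
    (nextCritical_le (isCritical_nextCritical R υ k) (hik.trans (le_nextCritical R υ k)))

/-- The last position of every carrel is critical, so the search to the right stops inside the
carrel. -/
theorem sameCarrel_nextCritical (R : Finset ℕ) (υ : Fin n → Fin n) (i : Fin n) :
    SameCarrel R i (nextCritical R υ i) := by
  have h1 := lt_carrelEnd R i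
  have h2 := carrelEnd_le R i
  have h3 : IsCritical R υ ⟨carrelEnd R i - 1, by omega⟩ := by
    apply IsCritical.last
    have : carrelEnd R i - 1 + 1 = carrelEnd R i := by omega
    simp only [this]
    exact (carrelEnd_eq_or_mem R i).symm
  have h4 : nextCritical R υ i ≤ ⟨carrelEnd R i - 1, by omega⟩ :=
    nextCritical_le h3 (Fin.le_def.2 (by simp only; omega))
  have h5 : (nextCritical R υ i : ℕ) ≤ carrelEnd R i - 1 := h4
  exact (sameCarrel_iff (le_nextCritical R υ i)).2 (by omega)

/-- The next critical index minimizes the excess `υ_k - k` over the rest of the carrel. -/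
theorem nextCritical_min (R : Finset ℕ) (υ : Fin n → Fin n) {i k : Fin n} (hik : i ≤ k)
    (hc : SameCarrel R i k) :
    (υ (nextCritical R υ i) : ℕ) + k ≤ υ k + nextCritical R υ i := by
  classical
  set x := nextCritical R υ i with hx
  have hix : SameCarrel R i x := sameCarrel_nextCritical R υ i
  rcases lt_trichotomy k x with h | rfl | h
  · by_contra hlt
    -- The positions before `x` with smaller excess than `x`. The largest of them would be critical
    -- by `IsCritical.next`, against the minimality of `x`.
    set S := Finset.univ.filter (fun y : Fin n =>
      i ≤ y ∧ y < x ∧ (υ y : ℕ) + x < υ x + y) with hS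
    have hne : S.Nonempty := ⟨k, Finset.mem_filter.2 ⟨Finset.mem_univ _, hik, h, by omega⟩⟩
    obtain ⟨-, h1, h2, h3⟩ := Finset.mem_filter.1 (S.max'_mem hne)
    have hcrit : IsCritical R υ (S.max' hne) := by
      refine IsCritical.next x _ (isCritical_nextCritical R υ i)
        ((hix.of_between h1 h2.le).symm.trans hix) h2 (by omega) ?_
      intro y hy1 hy2 hy3
      have : y ≤ S.max' hne := Finset.le_max' _ _
        (Finset.mem_filter.2 ⟨Finset.mem_univ _, h1.trans hy1.le, hy2, by omega⟩)
      exact absurd hy1 (not_lt.2 this)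
    exact absurd h2 (not_lt.2 (nextCritical_le hcrit h1))
  · exact le_rfl
  · exact ((isCritical_nextCritical R υ i).lt_of_lt k h (hix.symm.trans hc)).le

theorem staircase_add {R : Finset ℕ} {υ : Fin n → Fin n} (hυ : IsUpper υ) (i : Fin n) :
    (staircase R υ i : ℕ) + nextCritical R υ i = υ (nextCritical R υ i) + i := by
  have h1 : (i : ℕ) ≤ nextCritical R υ i := le_nextCritical R υ i
  have h2 : (nextCritical R υ i : ℕ) ≤ υ (nextCritical R υ i) := hυ _
  change (υ (nextCritical R υ i) : ℕ) - ((nextCritical R υ i : ℕ) - (i : ℕ)) + _ = _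
  omega

/-- The excess of the core at `i` is the minimum of `υ k - k` over the rest of the carrel, attained
at the next critical index. All properties of the core below use only this description. -/
theorem core_add_le {R : Finset ℕ} {υ : Fin n → Fin n} (hυ : IsUpper υ) {i k : Fin n} (hik : i ≤ k)
    (hc : SameCarrel R i k) : (core R υ i : ℕ) + k ≤ υ k + i := by
  have h1 := staircase_add (R := R) hυ i
  have h2 := nextCritical_min R υ hik hc
  change (staircase R υ i : ℕ) + k ≤ υ k + i
  omega

theorem core_le {R : Finset ℕ} {υ : Fin n → Fin n} (hυ : IsUpper υ) (i : Fin n) :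
    core R υ i ≤ υ i := by
  have := core_add_le hυ (le_refl i) (R := R) (fun _ _ => Iff.rfl)
  exact Fin.le_def.2 (by omega)

theorem isUpper_core {R : Finset ℕ} {υ : Fin n → Fin n} (hυ : IsUpper υ) : IsUpper (core R υ) := by
  intro i
  have h1 := staircase_add (R := R) hυ i
  have h2 : (nextCritical R υ i : ℕ) ≤ υ (nextCritical R υ i) := hυ _
  refine Fin.le_def.2 ?_
  change (i : ℕ) ≤ staircase R υ i
  omega

/-- The excess `α_i - i` is weakly increasing on each carrel. -/
def ExcessMono (R : Finset ℕ) (α : Fin n → Fin n) : Prop :=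
  ∀ i k, i ≤ k → SameCarrel R i k → (α i : ℕ) + k ≤ α k + i

theorem excessMono_core {R : Finset ℕ} {υ : Fin n → Fin n} (hυ : IsUpper υ) :
    ExcessMono R (core R υ) := by
  intro i k hik hc
  have h1 := staircase_add (R := R) hυ k
  have h2 := core_add_le hυ (hik.trans (le_nextCritical R υ k))
    (hc.trans (sameCarrel_nextCritical R υ k))
  change (core R υ i : ℕ) + k ≤ staircase R υ k + i
  omega

theorem ExcessMono.isIncreasing {R : Finset ℕ} {α : Fin n → Fin n} (h : ExcessMono R α) :
    IsIncreasing R α := by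
  intro i k hc hik
  have h1 := h i k hik.le hc
  have h2 : (i : ℕ) < k := hik
  exact Fin.lt_def.2 (by omega)

theorem ExcessMono.le {R : Finset ℕ} {α : Fin n → Fin n} (h : ExcessMono R α) {i k : Fin n}
    (hik : i ≤ k) (hc : SameCarrel R i k) : α i ≤ α k := by
  have h1 := h i k hik hc
  have h2 : (i : ℕ) ≤ k := hik
  exact Fin.le_def.2 (by omega)

/-- If the excess never drops, the minimum is already attained at `i`. Such a tuple is its own core,
and the staircases in its floor are its own entries. -/
theorem staircase_eq_self {R : Finset ℕ} {γ : Fin n → Fin n} (hγ : IsUpper γ)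
    (hm : ExcessMono R γ) (i : Fin n) : staircase R γ i = γ i := by
  have h1 := staircase_add (R := R) hγ i
  have h2 := nextCritical_min R γ (le_refl i) (fun _ _ => Iff.rfl)
  have h3 := hm i _ (le_nextCritical R γ i) (sameCarrel_nextCritical R γ i)
  exact Fin.ext (by omega)

/-! ### The floor map -/

theorem le_floorMap {R : Finset ℕ} {γ : Fin n → Fin n} (hγ : IsUpper γ)
    (hm : ExcessMono R γ) (i : Fin n) : γ i ≤ floorMap R γ i := by
  rw [floorMap, staircase_eq_self hγ hm]
  split_ifs
  · exact le_max_right _ _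
  · exact le_rfl

theorem floorMap_of_isCritical {R : Finset ℕ} {γ : Fin n → Fin n} (hγ : IsUpper γ)
    (hm : ExcessMono R γ) {x : Fin n} (hx : IsCritical R γ x) : floorMap R γ x = γ x := by
  rw [floorMap, staircase_eq_self hγ hm, nextCritical_eq_self hx, if_neg]
  simp

theorem isUpper_floorMap {R : Finset ℕ} {γ : Fin n → Fin n} (hγ : IsUpper γ)
    (hm : ExcessMono R γ) : IsUpper (floorMap R γ) :=
  fun i => (hγ i).trans (le_floorMap hγ hm i)

/-- In a gapless tuple the first critical entry of a carrel is at least the last entry of the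
preceding carrel. -/
theorem IsGapless.le_nextCritical {R : Finset ℕ} {γ : Fin n → Fin n} (hγ : IsGapless R γ)
    (hm : ExcessMono R γ) {a b : Fin n} (hab : (b : ℕ) = a + 1) (hb : (b : ℕ) ∈ R) :
    γ a ≤ γ (nextCritical R γ b) := by
  have hbx := RowBoundSums.le_nextCritical R γ b
  have hcx := sameCarrel_nextCritical R γ b
  rcases le_or_gt (γ a) (γ b) with h | h
  · exact h.trans (hm.le hbx hcx)
  obtain ⟨hend, hval⟩ := hγ.2.2 a b hab hb h _ rfl
  have h' : (γ b : ℕ) < γ a := h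
  have hn := carrelEnd_le R b
  -- The position where the run of consecutive entries given by gaplessness reaches `γ a`. The
  -- excess is constant along the run, whereas it rises strictly after a critical index, so no
  -- critical index precedes `c` in this carrel.
  set c : Fin n := ⟨b + (γ a - γ b), by omega⟩ with hc
  have hc' : (c : ℕ) = b + (γ a - γ b) := rfl
  have hbc : b ≤ c := Fin.le_def.2 (by omega)
  have hγc := hval c hbc (by omega)
  have hcb : SameCarrel R b c := (sameCarrel_iff hbc).2 (by omega)
  rcases le_or_gt c (nextCritical R γ b) with hle | hlt
  · have := hm.le hle (hcb.symm.trans hcx)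
    have h2 : (γ c : ℕ) ≤ γ (nextCritical R γ b) := this
    exact Fin.le_def.2 (by omega)
  · have h1 := (isCritical_nextCritical R γ b).lt_of_lt c hlt (hcx.symm.trans hcb)
    have hlt' : (nextCritical R γ b : ℕ) < c := hlt
    have h2 := hval _ hbx (by omega)
    omega

/-- If a critical index of the carrel is at or before `k`, then `γ a` is at most that critical
entry, hence at most `γ k`. Otherwise `k` lies before the leftmost critical index, where the floor
is a maximum with `γ a`. -/
theorem IsGapless.le_floorMap_of_carrelStart {R : Finset ℕ} {γ : Fin n → Fin n}
    (hγ : IsGapless R γ) (hm : ExcessMono R γ) {a k : Fin n}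
    (hak : (a : ℕ) + 1 = carrelStart R k) : γ a ≤ floorMap R γ k := by
  have hq := carrelStart_le R k
  have hR : carrelStart R k ∈ R := (carrelStart_eq_or_mem R k).resolve_left (by omega)
  set b : Fin n := ⟨carrelStart R k, lt_of_le_of_lt hq k.isLt⟩ with hb
  have hbk : b ≤ k := hq
  have hcb : SameCarrel R b k := fun q hqR =>
    ⟨fun h => by
      by_contra hlt
      exact absurd (le_carrelStart hqR (not_lt.1 hlt)) (not_le.2 h), fun h => lt_of_le_of_lt hq h⟩
  have key : ∀ z, b ≤ z → z ≤ k → IsCritical R γ z → γ a ≤ floorMap R γ k := fun z h1 h2 h3 =>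
    ((hγ.le_nextCritical hm (a := a) (b := b) hak.symm hR).trans
      (hm.le (nextCritical_le h3 h1) ((sameCarrel_nextCritical R γ b).symm.trans
        (hcb.of_between h1 h2)))).trans
      ((hm.le h2 ((hcb.of_between h1 h2).symm.trans hcb)).trans (le_floorMap hγ.1 hm k))
  rcases (RowBoundSums.le_nextCritical R γ k).eq_or_lt with heq | hlt
  · exact key k hbk le_rfl (heq ▸ isCritical_nextCritical R γ k)
  by_cases hex : ∃ z, SameCarrel R z k ∧ z < nextCritical R γ k ∧ IsCritical R γ z
  · obtain ⟨z, hz1, hz2, hz3⟩ := hex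
    have hzk : z ≤ k := by
      by_contra hkz
      exact absurd hz2 (not_lt.2 (nextCritical_le hz3 (not_le.1 hkz).le))
    refine key z (Fin.le_def.2 ?_) hzk hz3
    change carrelStart R k ≤ z
    rw [← hz1.carrelStart_eq]
    exact carrelStart_le R z
  · rw [floorMap, if_pos ⟨by omega, hlt, fun y h1 h2 h3 => hex ⟨y, h1, h2, h3⟩⟩]
    refine le_max_of_le_left (le_of_eq (congrArg γ (Fin.ext ?_)))
    change (a : ℕ) = carrelStart R k - 1
    omega

/-- Goes back carrel by carrel: the last position `p` of the preceding carrel is critical, so the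
floor there is `γ p`, which links the bound for `p` to the one for `k`. -/
theorem IsGapless.le_floorMap_of_lt {R : Finset ℕ} {γ : Fin n → Fin n}
    (hγ : IsGapless R γ) (hm : ExcessMono R γ) {x : Fin n} :
    ∀ m : ℕ, ∀ k : Fin n, (k : ℕ) = m → x < k → γ x ≤ floorMap R γ k := by
  intro m
  induction m using Nat.strong_induction_on with
  | _ m ih =>
    intro k hkm hxk
    have hxk' : (x : ℕ) < k := hxk
    by_cases hc : SameCarrel R x k
    · exact (hm.le hxk.le hc).trans (le_floorMap hγ.1 hm k)
    obtain ⟨q, hq, hxq, hqk⟩ : ∃ q ∈ R, (x : ℕ) < q ∧ q ≤ k := by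
      by_contra hne
      push Not at hne
      exact hc fun q hq => ⟨hne q hq, fun h => hxk'.trans h⟩
    have hq' := le_carrelStart hq hqk
    have hs := carrelStart_le R k
    have hR : carrelStart R k ∈ R := (carrelStart_eq_or_mem R k).resolve_left (by omega)
    set p : Fin n := ⟨carrelStart R k - 1, by omega⟩ with hp
    have hp' : (p : ℕ) + 1 = carrelStart R k := by simp only [hp]; omega
    have hpk := hγ.le_floorMap_of_carrelStart hm hp'
    have hxp : x ≤ p := Fin.le_def.2 (by omega)
    rcases hxp.eq_or_lt with heq | hlt
    · rw [heq]
      exact hpk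
    · have h1 := ih p (by omega) p rfl hlt
      rw [floorMap_of_isCritical hγ.1 hm (IsCritical.last p (Or.inl (hp' ▸ hR)))] at h1
      exact h1.trans hpk

/-- Raising entries to the last entry of the preceding carrel does not overshoot the first critical
entry, by `IsGapless.le_nextCritical`. -/
theorem IsGapless.floorMap_le_nextCritical {R : Finset ℕ} {γ : Fin n → Fin n}
    (hγ : IsGapless R γ) (hm : ExcessMono R γ) (i : Fin n) :
    floorMap R γ i ≤ γ (nextCritical R γ i) := by
  have hi := hm.le (RowBoundSums.le_nextCritical R γ i) (sameCarrel_nextCritical R γ i)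
  rw [floorMap, staircase_eq_self hγ.1 hm]
  split_ifs with h
  · obtain ⟨h0, hlt, hno⟩ := h
    refine max_le ?_ hi
    have hs := carrelStart_le R i
    have hR : carrelStart R i ∈ R := (carrelStart_eq_or_mem R i).resolve_left h0.ne'
    set b : Fin n := ⟨carrelStart R i, lt_of_le_of_lt hs i.isLt⟩ with hb
    have hbi : SameCarrel R b i := fun q hqR =>
      ⟨fun h => by
        by_contra hlt
        exact absurd (le_carrelStart hqR (not_lt.1 hlt)) (not_le.2 h), fun h => lt_of_le_of_lt hs h⟩
    have hle : nextCritical R γ b ≤ nextCritical R γ i :=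
      nextCritical_le (isCritical_nextCritical R γ i)
        ((show b ≤ i from hs).trans (RowBoundSums.le_nextCritical R γ i))
    have heq : nextCritical R γ b = nextCritical R γ i := by
      refine hle.eq_or_lt.resolve_right fun h => hno _ ?_ h (isCritical_nextCritical R γ b)
      exact (sameCarrel_nextCritical R γ b).symm.trans hbi
    rw [← heq]
    exact hγ.le_nextCritical hm (b := b) (by simp only [hb]; omega) hR
  · exact hi

/-- If a critical index separates `i` from `k`, its entry separates the two floor values. Otherwise
both positions have the same next critical index, and the excess of `γ` decides. -/
theorem IsGapless.isFlag_floorMap {R : Finset ℕ} {γ : Fin n → Fin n} (hγ : IsGapless R γ)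
    (hm : ExcessMono R γ) : IsFlag (floorMap R γ) := by
  intro i k hik
  rcases lt_or_ge (nextCritical R γ i) k with h | h
  · exact (hγ.floorMap_le_nextCritical hm i).trans
      (hγ.le_floorMap_of_lt hm k k rfl h)
  have hnext := nextCritical_eq_of_le hik h
  rcases h.eq_or_lt with h | h
  · have hk : IsCritical R γ k := h ▸ isCritical_nextCritical R γ i
    rw [floorMap_of_isCritical hγ.1 hm hk, h]
    exact hγ.floorMap_le_nextCritical hm i
  · have hc : SameCarrel R i k := (sameCarrel_nextCritical R γ i).of_between hik h.le
    have hstart := hc.carrelStart_eq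
    by_cases hcond : 0 < carrelStart R i ∧ i < nextCritical R γ i ∧
      ∀ y : Fin n, SameCarrel R y i → y < nextCritical R γ i → ¬ IsCritical R γ y
    · have hcond' : 0 < carrelStart R k ∧ k < nextCritical R γ k ∧
          ∀ y : Fin n, SameCarrel R y k → y < nextCritical R γ k → ¬ IsCritical R γ y := by
        rw [hnext, ← hstart]
        exact ⟨hcond.1, h, fun y hy => hcond.2.2 y (hy.trans hc.symm)⟩
      rw [floorMap, floorMap, if_pos hcond, if_pos hcond', staircase_eq_self hγ.1 hm,
        staircase_eq_self hγ.1 hm]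
      simp only [hstart]
      exact max_le_max le_rfl (hm.le hik hc)
    · rw [floorMap, if_neg hcond, staircase_eq_self hγ.1 hm]
      exact (hm.le hik hc).trans (le_floorMap hγ.1 hm k)

end Tuples

/-! ### Sorted prefixes of a permutation -/

section Prefix

variable {n : ℕ}

theorem mem_prefixSet {π : Equiv.Perm (Fin n)} {q : ℕ} {x : Fin n} :
    x ∈ prefixSet π q ↔ (π.symm x : ℕ) < q := by
  simp only [prefixSet, Finset.mem_map, Finset.mem_filter, Finset.mem_univ, true_and,
    Equiv.coe_toEmbedding]
  constructor
  · rintro ⟨k, hk, rfl⟩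
    simpa using hk
  · exact fun h => ⟨_, h, by simp⟩

/-- The `i`-th smallest of the first `q` values of `π`. -/
def sortedPrefix (π : Equiv.Perm (Fin n)) (q i : ℕ) : ℕ :=
  if h : q ≤ n ∧ i < q then (prefixSet π q).orderEmbOfFin (card_prefixSet π h.1) ⟨i, h.2⟩ else 0

theorem sortedPrefix_lt {π : Equiv.Perm (Fin n)} {q i k : ℕ} (hq : q ≤ n) (hik : i < k)
    (hk : k < q) : sortedPrefix π q i < sortedPrefix π q k := by
  rw [sortedPrefix, sortedPrefix, dif_pos ⟨hq, hik.trans hk⟩, dif_pos ⟨hq, hk⟩]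
  exact ((prefixSet π q).orderEmbOfFin (card_prefixSet π hq)).strictMono hik

theorem sortedPrefix_mem {π : Equiv.Perm (Fin n)} {q i : ℕ} (hq : q ≤ n) (hi : i < q) :
    ∃ x ∈ prefixSet π q, (x : ℕ) = sortedPrefix π q i := by
  rw [sortedPrefix, dif_pos ⟨hq, hi⟩]
  exact ⟨_, Finset.orderEmbOfFin_mem _ _ _, rfl⟩

theorem exists_sortedPrefix {π : Equiv.Perm (Fin n)} {q : ℕ} (hq : q ≤ n) {x : Fin n}
    (hx : x ∈ prefixSet π q) : ∃ i < q, sortedPrefix π q i = x := by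
  have : x ∈ Set.range ((prefixSet π q).orderEmbOfFin (card_prefixSet π hq)) := by
    rw [Finset.range_orderEmbOfFin]
    exact hx
  obtain ⟨i, hi⟩ := this
  refine ⟨i, i.isLt, ?_⟩
  rw [sortedPrefix, dif_pos ⟨hq, i.isLt⟩, ← hi]

theorem sortedPrefix_unique {π : Equiv.Perm (Fin n)} {q : ℕ} (hq : q ≤ n) {f : ℕ → ℕ}
    (hf : ∀ i < q, ∃ x ∈ prefixSet π q, (x : ℕ) = f i) (hmono : ∀ i k, i < k → k < q → f i < f k)
    {i : ℕ} (hi : i < q) : f i = sortedPrefix π q i := by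
  choose g hg hgf using hf
  have h := Finset.orderEmbOfFin_unique (card_prefixSet π hq) (f := fun i : Fin q => g i i.isLt)
    (fun x => hg _ _) (fun a b hab => Fin.lt_def.2 (by
      rw [hgf, hgf]
      exact hmono a b hab b.isLt))
  have h' := congrFun h ⟨i, hi⟩
  rw [sortedPrefix, dif_pos ⟨hq, hi⟩, ← h', ← hgf i hi]

theorem rankTuple_eq_sortedPrefix (R : Finset ℕ) (π : Equiv.Perm (Fin n)) (i : Fin n) :
    (rankTuple R π i : ℕ) = sortedPrefix π (carrelEnd R i) i := by
  rw [sortedPrefix, dif_pos ⟨carrelEnd_le R i, lt_carrelEnd R i⟩]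
  rfl

theorem sortedPrefix_self (π : Equiv.Perm (Fin n)) {i : ℕ} (hi : i < n) :
    sortedPrefix π n i = i := by
  refine (sortedPrefix_unique (π := π) le_rfl (f := fun i => i) (fun k hk => ?_)
    (fun _ _ h _ => h) hi).symm
  exact ⟨⟨k, hk⟩, mem_prefixSet.2 (Fin.isLt _), rfl⟩

theorem prefixSet_mono (π : Equiv.Perm (Fin n)) {q q' : ℕ} (h : q ≤ q') :
    prefixSet π q ⊆ prefixSet π q' :=
  fun _ hx => mem_prefixSet.2 ((mem_prefixSet.1 hx).trans_le h)

/-- If more than `i` of the first `q` values of `f` are less than `z`, so is its `i`-th value,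
for `f` strictly increasing. -/
theorem lt_of_card_lt {f : ℕ → ℕ} {q i z : ℕ} (hmono : ∀ i k, i < k → k < q → f i < f k)
    {S : Finset ℕ} (hS : ∀ s ∈ S, s < z ∧ ∃ k < q, f k = s) (hcard : i < S.card) :
    i < q ∧ f i < z := by
  by_contra hcon
  have hsub : S ⊆ (Finset.range i).image f := by
    intro s hs
    obtain ⟨hsz, k, hk, rfl⟩ := hS s hs
    refine Finset.mem_image_of_mem f (Finset.mem_range.2 ?_)
    by_contra hik
    rcases (not_lt.1 hik).eq_or_lt with rfl | h
    · exact hcon ⟨hk, hsz⟩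
    · exact hcon ⟨h.trans hk, (hmono _ _ h hk).trans hsz⟩
  exact absurd ((Finset.card_le_card hsub).trans Finset.card_image_le)
    (by rw [Finset.card_range]; omega)

theorem injOn_of_lt {f : ℕ → ℕ} {q : ℕ} (hmono : ∀ i k, i < k → k < q → f i < f k) :
    Set.InjOn f (Finset.range q : Finset ℕ) := by
  intro a ha b hb hab
  rw [Finset.mem_coe, Finset.mem_range] at ha hb
  rcases lt_trichotomy a b with h | h | h
  · exact absurd hab (hmono a b h hb).ne
  · exact h
  · exact absurd hab (hmono b a h ha).ne'

/-- The `i + 1` smallest elements of the smaller prefix all belong to the larger one, which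
therefore has at least that many elements up to this bound. -/
theorem sortedPrefix_anti (π : Equiv.Perm (Fin n)) {q q' i : ℕ} (hq : q ≤ q') (hq' : q' ≤ n)
    (hi : i < q) : sortedPrefix π q' i ≤ sortedPrefix π q i := by
  have hm : ∀ i k, i < k → k < q → sortedPrefix π q i < sortedPrefix π q k :=
    fun _ _ => sortedPrefix_lt (hq.trans hq')
  have := lt_of_card_lt (f := sortedPrefix π q') (q := q') (i := i) (z := sortedPrefix π q i + 1)
    (S := (Finset.range (i + 1)).image (sortedPrefix π q))
    (fun _ _ => sortedPrefix_lt hq') ?_ ?_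
  · omega
  · intro s hs
    obtain ⟨k, hk, rfl⟩ := Finset.mem_image.1 hs
    rw [Finset.mem_range] at hk
    obtain ⟨x, hx, hxe⟩ := sortedPrefix_mem (π := π) (hq.trans hq') (show k < q by omega)
    refine ⟨?_, hxe ▸ exists_sortedPrefix hq' (prefixSet_mono π hq hx)⟩
    rcases (Nat.lt_succ_iff.1 hk).eq_or_lt with rfl | h
    · omega
    · have := hm k i h hi
      omega
  · rw [Finset.card_image_of_injOn, Finset.card_range]
    · omega
    · exact (injOn_of_lt hm).mono (by
        intro a ha
        simp only [Finset.coe_range, Set.mem_Iio] at ha ⊢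
        omega)

end Prefix

/-! ### Tableaux -/

section Tableaux

variable {n : ℕ} {lam : NPartition n}

theorem mem_tableaux_iff {T : ℕ → ℕ → ℕ} :
    T ∈ tableaux lam ↔
      (∀ i j k, j < k → i < lam.1.colLen k → T i j ≤ T i k) ∧
      (∀ i k j, i < k → k < lam.1.colLen j → T i j < T k j) ∧
      (∀ i j, lam.1.colLen j ≤ i → T i j = 0) ∧
      (∀ i j, i < lam.1.colLen j → T i j < n) := by
  constructor
  · rintro ⟨S, rfl, hS⟩
    refine ⟨fun i j k hj hi => S.row_weak hj (YoungDiagram.mem_iff_lt_colLen.2 hi),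
      fun i k j hi hk => S.col_strict hi (YoungDiagram.mem_iff_lt_colLen.2 hk),
      fun i j h => S.zeros fun h' => ?_,
      fun i j h => hS i j (YoungDiagram.mem_iff_lt_colLen.2 h)⟩
    exact absurd (YoungDiagram.mem_iff_lt_colLen.1 h') (not_lt.2 h)
  · rintro ⟨h1, h2, h3, h4⟩
    refine ⟨⟨T, ?_, ?_, ?_⟩, rfl, ?_⟩
    · exact fun {i j k} hj h => h1 i j k hj (YoungDiagram.mem_iff_lt_colLen.1 h)
    · exact fun {i k j} hi h => h2 i k j hi (YoungDiagram.mem_iff_lt_colLen.1 h)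
    · exact fun {i j} h => h3 i j (not_lt.1 fun h' => h (YoungDiagram.mem_iff_lt_colLen.2 h'))
    · exact fun i j h => h4 i j (YoungDiagram.mem_iff_lt_colLen.1 h)

theorem row_le {T : ℕ → ℕ → ℕ} (hT : T ∈ tableaux lam) {i j k : ℕ} (hjk : j ≤ k)
    (hi : i < lam.1.colLen k) : T i j ≤ T i k := by
  rcases hjk.eq_or_lt with rfl | h
  · exact le_rfl
  · exact (mem_tableaux_iff.1 hT).1 i j k h hi

theorem col_lt {T : ℕ → ℕ → ℕ} (hT : T ∈ tableaux lam) {i k j : ℕ} (hik : i < k)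
    (hk : k < lam.1.colLen j) : T i j < T k j :=
  (mem_tableaux_iff.1 hT).2.1 i k j hik hk

theorem col_add_le {T : ℕ → ℕ → ℕ} (hT : T ∈ tableaux lam) {i k j : ℕ} (hik : i ≤ k)
    (hk : k < lam.1.colLen j) : T i j + k ≤ T k j + i := by
  induction k, hik using Nat.le_induction with
  | base => exact le_rfl
  | succ m hm ih =>
    have h1 := ih (by omega)
    have h2 := col_lt hT (Nat.lt_add_one m) hk
    omega

theorem row_le_value {T : ℕ → ℕ → ℕ} (hT : T ∈ tableaux lam) {i j : ℕ} (hi : i < lam.1.colLen j) :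
    i ≤ T i j := by
  have := col_add_le hT (Nat.zero_le i) hi
  omega

theorem le_of_forall_shape {T U : ℕ → ℕ → ℕ} (hT : T ∈ tableaux lam)
    (h : ∀ i j, i < lam.1.colLen j → T i j ≤ U i j) : T ≤ U := by
  intro i j
  rcases lt_or_ge i (lam.1.colLen j) with hi | hi
  · exact h i j hi
  · rw [(mem_tableaux_iff.1 hT).2.2.1 i j hi]
    exact Nat.zero_le _

theorem mem_rowBoundSet_iff {β : Fin n → Fin n} {T : ℕ → ℕ → ℕ} :
    T ∈ rowBoundSet lam β ↔
      T ∈ tableaux lam ∧ ∀ (i : Fin n) (j : ℕ), (i : ℕ) < lam.1.colLen j → T i j ≤ β i := by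
  simp only [rowBoundSet, Set.mem_ofPred_eq, YoungDiagram.mem_iff_lt_colLen]

/-! ### Column lengths -/

theorem colLen_pos_iff {j : ℕ} : 0 < lam.1.colLen j ↔ j < lam.1.rowLen 0 := by
  rw [← YoungDiagram.mem_iff_lt_colLen, YoungDiagram.mem_iff_lt_rowLen]

theorem colLen_mem_columnLengths {j : ℕ} (h0 : 0 < lam.1.colLen j) (hn : lam.1.colLen j < n) :
    lam.1.colLen j ∈ columnLengths lam :=
  Finset.mem_filter.2
    ⟨Finset.mem_image_of_mem _ (Finset.mem_range.2 (colLen_pos_iff.1 h0)), hn⟩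

theorem mem_columnLengths {q : ℕ} (hq : q ∈ columnLengths lam) :
    0 < q ∧ q < n ∧ ∃ j, lam.1.colLen j = q := by
  obtain ⟨h1, h2⟩ := Finset.mem_filter.1 hq
  obtain ⟨j, hj, rfl⟩ := Finset.mem_image.1 h1
  exact ⟨colLen_pos_iff.2 (Finset.mem_range.1 hj), h2, j, rfl⟩

/-- A nonempty column has length `n` or a divider as its length, so it cannot end inside a carrel.
-/
theorem lt_colLen_of_sameCarrel {i k : Fin n} {j : ℕ} (h : SameCarrel (columnLengths lam) i k)
    (hi : (i : ℕ) < lam.1.colLen j) : (k : ℕ) < lam.1.colLen j := by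
  rcases (colLen_le lam j).eq_or_lt with he | hlt
  · rw [he]
    exact k.isLt
  · exact (h _ (colLen_mem_columnLengths (by omega) hlt)).1 hi

/-! ### Row bound sets and cores -/

/-- The column of the box reaches the next critical row `x`, and strictness turns the bound at `x`
into `γ x - (x - i)` at `i`. Keeping `φ` apart from `γ` lets the lemma serve both the core and the
floor. -/
theorem le_of_le_at_critical {γ φ : Fin n → Fin n} (hγ : IsUpper γ)
    (hφ : ∀ x, IsCritical (columnLengths lam) γ x → φ x ≤ γ x) {T : ℕ → ℕ → ℕ}
    (hT : T ∈ rowBoundSet lam φ) {i : Fin n} {j : ℕ} (hi : (i : ℕ) < lam.1.colLen j) :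
    T i j ≤ core (columnLengths lam) γ i := by
  rw [mem_rowBoundSet_iff] at hT
  have hxj := lt_colLen_of_sameCarrel (sameCarrel_nextCritical (columnLengths lam) γ i) hi
  have h1 := col_add_le hT.1 (le_nextCritical (columnLengths lam) γ i) hxj
  have h2 := hT.2 _ j hxj
  have h3 := Fin.le_def.1 <| hφ _ (isCritical_nextCritical (columnLengths lam) γ i)
  have h4 := staircase_add (R := columnLengths lam) hγ i
  change T i j ≤ staircase (columnLengths lam) γ i
  omega

theorem rowBoundSet_mono {β φ : Fin n → Fin n} (h : β ≤ φ) :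
    rowBoundSet lam β ⊆ rowBoundSet lam φ := by
  intro T hT
  rw [mem_rowBoundSet_iff] at hT ⊢
  exact ⟨hT.1, fun i j hi => (hT.2 i j hi).trans (h i)⟩

theorem rowBoundSet_core {β : Fin n → Fin n} (hβ : IsUpper β) :
    rowBoundSet lam (core (columnLengths lam) β) = rowBoundSet lam β := by
  refine (rowBoundSet_mono (core_le hβ)).antisymm fun T hT => ?_
  exact mem_rowBoundSet_iff.2 ⟨hT.1, fun i j hi =>
    le_of_le_at_critical hβ (fun _ _ => le_rfl) hT hi⟩

theorem rowBoundSet_floorMap {γ : Fin n → Fin n} (hγ : IsUpper γ)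
    (hm : ExcessMono (columnLengths lam) γ) :
    rowBoundSet lam (floorMap (columnLengths lam) γ) = rowBoundSet lam γ := by
  refine Set.Subset.antisymm (fun T hT => ?_) (rowBoundSet_mono (le_floorMap hγ hm))
  refine mem_rowBoundSet_iff.2 ⟨hT.1, fun i j hi => ?_⟩
  have := le_of_le_at_critical hγ (fun x hx => (floorMap_of_isCritical hγ hm hx).le) hT hi
  rwa [core, staircase_eq_self hγ hm] at this

theorem bddAbove_entries (lam : NPartition n) (β : Fin n → Fin n) (i j : ℕ) :
    BddAbove ((fun T : ℕ → ℕ → ℕ => T i j) '' rowBoundSet lam β) :=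
  (((tableaux_finite lam).subset (rowBoundSet_subset lam β)).image _).bddAbove

theorem rowBoundMax_eq_core {β : Fin n → Fin n} (hβ : IsUpper β) {i : Fin n} {j : ℕ}
    (hj : lam.1.colLen j = carrelEnd (columnLengths lam) i) :
    rowBoundMax lam β i j = core (columnLengths lam) β i := by
  have hij : (i : ℕ) < lam.1.colLen j := hj ▸ lt_carrelEnd _ i
  have hup : (i : ℕ) ≤ core (columnLengths lam) β i := isUpper_core hβ i
  set c : ℕ := core (columnLengths lam) β i - i with hc
  -- Rows from `i` on in the columns from `j` on stay in the carrel of `i`, because column `j` ends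
  -- at the carrel end; there the excess of `β` is at least `c`.
  have hck : ∀ (i' j' : ℕ) (h : i' < lam.1.colLen j'), (i : ℕ) ≤ i' → j ≤ j' →
      i' + c ≤ β ⟨i', h.trans_le (colLen_le lam j')⟩ := by
    intro i' j' h h1 h2
    have h3 := lam.1.colLen_anti j j' h2
    have h4 := core_add_le hβ (R := columnLengths lam) (i := i)
      (k := ⟨i', h.trans_le (colLen_le lam j')⟩) h1 ((sameCarrel_iff h1).2 (by
        change i' < _
        omega))
    change (core (columnLengths lam) β i : ℕ) + i' ≤ _ at h4
    omega
  -- A witness for attainment: the superstandard tableau with the boxes weakly below and to the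
  -- right of `(i, j)` raised by `c`.
  set T : ℕ → ℕ → ℕ := fun i' j' =>
    if i' < lam.1.colLen j' then i' + if (i : ℕ) ≤ i' ∧ j ≤ j' then c else 0 else 0 with hTdef
  have hle : ∀ (i' j' : ℕ) (h : i' < lam.1.colLen j'),
      T i' j' ≤ β ⟨i', h.trans_le (colLen_le lam j')⟩ := by
    intro i' j' h
    have h0 : i' ≤ β ⟨i', h.trans_le (colLen_le lam j')⟩ := hβ ⟨i', _⟩
    simp only [hTdef, if_pos h]
    split_ifs with h1
    · exact hck i' j' h h1.1 h1.2
    · exact h0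
  have hT : T ∈ rowBoundSet lam β := by
    refine mem_rowBoundSet_iff.2 ⟨mem_tableaux_iff.2 ⟨?_, ?_, ?_, ?_⟩, fun k l h => hle k l h⟩
    · intro k a b hab hk
      have := lam.1.colLen_anti a b hab.le
      simp only [hTdef, if_pos hk, if_pos (show k < lam.1.colLen a by omega)]
      split_ifs <;> omega
    · intro k l a hkl hl
      simp only [hTdef, if_pos hl, if_pos (hkl.trans hl)]
      split_ifs <;> omega
    · intro k a h
      simp only [hTdef, if_neg (not_lt.2 h)]
    · intro k a h
      exact (hle k a h).trans_lt (Fin.isLt _)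
  apply le_antisymm
  · refine csSup_le ⟨_, T, hT, rfl⟩ ?_
    rintro _ ⟨U, hU, rfl⟩
    exact le_of_le_at_critical hβ (fun _ _ => le_rfl) hU hij
  · have h1 := le_csSup (bddAbove_entries lam β i j) ⟨T, hT, rfl⟩
    have h2 : T i j = core (columnLengths lam) β i := by
      simp only [hTdef, if_pos hij, le_refl, and_self, if_true]
      omega
    rw [← h2]
    exact h1

/-! ### Keys -/

theorem key_apply (lam : NPartition n) (π : Equiv.Perm (Fin n)) (i j : ℕ) :
    key lam π i j = sortedPrefix π (lam.1.colLen j) i := by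
  rw [key, sortedPrefix]
  have := colLen_le lam j
  split_ifs with h1 h2 h2
  · rfl
  · exact absurd ⟨this, h1⟩ h2
  · exact absurd h2.2 h1
  · rfl

theorem key_mem_tableaux (lam : NPartition n) (π : Equiv.Perm (Fin n)) :
    key lam π ∈ tableaux lam := by
  refine mem_tableaux_iff.2 ⟨?_, ?_, ?_, ?_⟩
  · intro i j k hjk hi
    rw [key_apply, key_apply]
    exact sortedPrefix_anti π (lam.1.colLen_anti j k hjk.le) (colLen_le lam j) hi
  · intro i k j hik hk
    rw [key_apply, key_apply]
    exact sortedPrefix_lt (colLen_le lam j) hik hk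
  · intro i j h
    exact dif_neg (not_lt.2 h)
  · intro i j h
    obtain ⟨x, -, hx⟩ := sortedPrefix_mem (π := π) (colLen_le lam j) h
    rw [key_apply, ← hx]
    exact x.isLt

theorem key_nested (lam : NPartition n) (π : Equiv.Perm (Fin n)) {i j k : ℕ} (hjk : j ≤ k)
    (hi : i < lam.1.colLen k) : ∃ l < lam.1.colLen j, key lam π l j = key lam π i k := by
  obtain ⟨x, hx, hxe⟩ := sortedPrefix_mem (π := π) (colLen_le lam k) hi
  obtain ⟨l, hl, hle⟩ := exists_sortedPrefix (colLen_le lam j)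
    (prefixSet_mono π (lam.1.colLen_anti j k hjk) hx)
  exact ⟨l, hl, by rw [key_apply, key_apply, hle, hxe]⟩

theorem core_eq_rankTuple {β : Fin n → Fin n} (hβ : IsUpper β) {π : Equiv.Perm (Fin n)}
    (h : rowBoundMax lam β = key lam π) :
    core (columnLengths lam) β = rankTuple (columnLengths lam) π := by
  funext i
  apply Fin.ext
  rw [rankTuple_eq_sortedPrefix]
  rcases carrelEnd_eq_or_mem (columnLengths lam) i with he | he
  -- On the last carrel there need not be a column of length `n` to compare. The excess of the core
  -- is at most that of `β` at `n - 1`, which is `0`, so both tuples are the identity there.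
  · rw [he, sortedPrefix_self π i.isLt]
    have hi := i.isLt
    have h1 := core_add_le hβ (R := columnLengths lam) (i := i) (k := ⟨n - 1, by omega⟩)
      (Fin.le_def.2 (by simp only; omega))
      ((sameCarrel_iff (Fin.le_def.2 (by simp only; omega))).2 (by simp only; omega))
    have h2 : (i : ℕ) ≤ core (columnLengths lam) β i := isUpper_core hβ i
    have h3 := (β ⟨n - 1, by omega⟩).isLt
    simp only at h1
    omega
  · obtain ⟨-, -, j, hj⟩ := mem_columnLengths he
    rw [← hj, ← key_apply, ← h, rowBoundMax_eq_core hβ hj]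

end Tableaux

/-! ### Scanning -/

section Scan

theorem ewisFrom_subset : ∀ (v : ℕ) (l : List (ℕ × ℕ)), ewisFrom v l ⊆ l
  | _, [] => List.Subset.refl _
  | v, (k, x) :: l => by
    rw [ewisFrom]
    split_ifs
    · exact List.cons_subset_cons _ (ewisFrom_subset x l)
    · exact List.subset_cons_of_subset _ (ewisFrom_subset v l)

theorem le_of_mem_ewisFrom : ∀ (v : ℕ) (l : List (ℕ × ℕ)), ∀ p ∈ ewisFrom v l, v ≤ p.2
  | _, [], p, hp => by simp [ewisFrom] at hp
  | v, (k, x) :: l, p, hp => by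
    rw [ewisFrom] at hp
    split_ifs at hp with h
    · rcases List.mem_cons.1 hp with rfl | hp
      · exact h
      · exact h.trans (le_of_mem_ewisFrom x l p hp)
    · exact le_of_mem_ewisFrom v l p hp

/-- When the current value already bounds everything to come, only equal values can extend the
sequence. This describes every scanning path of a tableau with nested columns. -/
theorem ewisFrom_eq_filter (v : ℕ) : ∀ l : List (ℕ × ℕ), (∀ p ∈ l, p.2 ≤ v) →
    ewisFrom v l = l.filter (fun p => decide (p.2 = v))
  | [], _ => rfl
  | (k, x) :: l, hl => by
    have hx : x ≤ v := hl _ List.mem_cons_self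
    have ih := ewisFrom_eq_filter v l fun p hp => hl p (List.mem_cons_of_mem _ hp)
    rw [ewisFrom]
    rcases hx.eq_or_lt with rfl | h
    · rw [if_pos le_rfl, ih, List.filter_cons_of_pos (by simp)]
    · rw [if_neg (not_le.2 h), ih, List.filter_cons_of_neg (by simpa using h.ne)]

theorem exists_getLast?_eq {l : List (ℕ × ℕ)} (hl : l ≠ []) :
    ∃ p ∈ l, (l.getLast?.map Prod.snd).getD 0 = p.2 :=
  ⟨l.getLast hl, List.getLast_mem hl, by simp [List.getLast?_eq_some_getLast hl]⟩

variable {n : ℕ} {lam : NPartition n}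

theorem bottoms_eq_cons (T : ℕ → ℕ → ℕ) {j : ℕ} {c : ℕ → ℕ} (hj : j < lam.1.rowLen 0)
    (hc : 0 < c j) :
    bottoms lam T j c = (j, T (c j - 1) j) :: bottoms lam T (j + 1) c := by
  rw [bottoms, bottoms, show lam.1.rowLen 0 - j = lam.1.rowLen 0 - (j + 1) + 1 by omega,
    List.range'_succ, List.filter_cons_of_pos (by simpa using hc), List.map_cons]

theorem mem_bottoms {T : ℕ → ℕ → ℕ} {j : ℕ} {c : ℕ → ℕ} {p : ℕ × ℕ} :
    p ∈ bottoms lam T j c ↔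
      j ≤ p.1 ∧ p.1 < lam.1.rowLen 0 ∧ 0 < c p.1 ∧ p.2 = T (c p.1 - 1) p.1 := by
  simp only [bottoms, List.mem_map, List.mem_filter, List.mem_range'_1, decide_eq_true_eq]
  constructor
  · rintro ⟨k, ⟨⟨h1, h2⟩, h3⟩, rfl⟩
    exact ⟨h1, by simp only; omega, h3, rfl⟩
  · rintro ⟨h1, h2, h3, h4⟩
    exact ⟨p.1, ⟨⟨h1, by omega⟩, h3⟩, Prod.ext rfl h4.symm⟩

theorem ewis_bottoms (T : ℕ → ℕ → ℕ) {j : ℕ} {c : ℕ → ℕ} (hj : j < lam.1.rowLen 0)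
    (hc : 0 < c j) : ewis (bottoms lam T j c) =
      (j, T (c j - 1) j) :: ewisFrom (T (c j - 1) j) (bottoms lam T (j + 1) c) := by
  rw [bottoms_eq_cons T hj hc, ewis]

theorem removePath_le (T : ℕ → ℕ → ℕ) (j : ℕ) (c : ℕ → ℕ) (k : ℕ) :
    removePath lam T j c k ≤ c k := by
  rw [removePath]
  split_ifs <;> omega

/-- Every path starts in column `j`, which therefore loses exactly one box per path. -/
theorem iterate_removePath_self (T : ℕ → ℕ → ℕ) (j m : ℕ) (hm : m ≤ lam.1.colLen j) :
    (removePath lam T j)^[m] lam.1.colLen j = lam.1.colLen j - m := by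
  induction m with
  | zero => rfl
  | succ m ih =>
    have ih := ih (by omega)
    rw [Function.iterate_succ_apply', removePath, if_pos, ih]
    · omega
    · rw [ewis_bottoms T (colLen_pos_iff.1 (by omega)) (by omega)]
      simp

theorem scan_apply (T : ℕ → ℕ → ℕ) {i j : ℕ} (hi : i < lam.1.colLen j) :
    scan lam T i j = (((ewis (bottoms lam T j
      ((removePath lam T j)^[lam.1.colLen j - 1 - i] lam.1.colLen))).getLast?).map
        Prod.snd).getD 0 :=
  if_pos (YoungDiagram.mem_iff_lt_colLen.2 hi)

/-- The path that fills the box `(i, j)` starts at that box of `T` and is weakly increasing. -/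
theorem le_scan (T : ℕ → ℕ → ℕ) {i j : ℕ} (hi : i < lam.1.colLen j) : T i j ≤ scan lam T i j := by
  have hc := iterate_removePath_self (lam := lam) T j (lam.1.colLen j - 1 - i) (by omega)
  have hv : lam.1.colLen j - (lam.1.colLen j - 1 - i) - 1 = i := by omega
  rw [scan_apply T hi, ewis_bottoms T (colLen_pos_iff.1 (by omega)) (by omega), hc, hv]
  obtain ⟨p, hp, he⟩ := exists_getLast?_eq (List.cons_ne_nil (j, T i j)
    (ewisFrom (T i j) (bottoms lam T (j + 1)
      ((removePath lam T j)^[lam.1.colLen j - 1 - i] lam.1.colLen))))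
  rw [he]
  rcases List.mem_cons.1 hp with rfl | hp
  · exact le_rfl
  · exact le_of_mem_ewisFrom _ _ _ hp

/-- After `m` scanning paths have been removed from a tableau with nested columns, the boxes left
in a column `k ≥ j` are those with the values of the top `colLen j - m` boxes of the column `j`. -/
theorem iterate_removePath_of_nested {T : ℕ → ℕ → ℕ} (hT : T ∈ tableaux lam) {j : ℕ}
    (hnest : ∀ k, j ≤ k → ∀ i < lam.1.colLen k, ∃ l < lam.1.colLen j, T l j = T i k)
    (m : ℕ) (hm : m ≤ lam.1.colLen j) (k : ℕ) (hk : j ≤ k) :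
    (removePath lam T j)^[m] lam.1.colLen k ≤ lam.1.colLen k ∧
      ∀ i < lam.1.colLen k, (i < (removePath lam T j)^[m] lam.1.colLen k ↔
        ∃ l < lam.1.colLen j - m, T l j = T i k) := by
  induction m generalizing k with
  | zero => exact ⟨le_rfl, fun i hi => iff_of_true hi (hnest k hk i hi)⟩
  | succ m ih =>
    have ih := fun k hk => ih (by omega) k hk
    have hcj := iterate_removePath_self (lam := lam) T j m (by omega)
    rw [Function.iterate_succ_apply']
    set c := (removePath lam T j)^[m] lam.1.colLen with hc
    set v := T (lam.1.colLen j - m - 1) j with hv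
    have hle : ∀ l < lam.1.colLen j - m, T l j ≤ v := fun l hl => by
      have := col_add_le hT (j := j) (show l ≤ lam.1.colLen j - m - 1 by omega) (by omega)
      omega
    -- The remaining boxes carry only values still present in column `j`, whose maximum is `v`. So
    -- the path removes exactly the bottom boxes of value `v`.
    have hbot : ∀ p ∈ bottoms lam T (j + 1) c, p.2 ≤ v := by
      intro p hp
      obtain ⟨h1, -, h3, h4⟩ := mem_bottoms.1 hp
      have h5 := ih p.1 (by omega)
      obtain ⟨l, hl, hle'⟩ := (h5.2 (c p.1 - 1) (by omega)).1 (by omega)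
      rw [h4, ← hle']
      exact hle l hl
    have hpath : ewis (bottoms lam T j c) =
        (j, v) :: (bottoms lam T (j + 1) c).filter (fun p => decide (p.2 = v)) := by
      rw [ewis_bottoms T (colLen_pos_iff.1 (by omega)) (by omega), hcj, ← hv,
        ewisFrom_eq_filter v _ hbot]
    have hmem : k ∈ (ewis (bottoms lam T j c)).map Prod.fst ↔
        0 < c k ∧ T (c k - 1) k = v := by
      rw [hpath]
      simp only [List.map_cons, List.mem_cons, List.mem_map, List.mem_filter, decide_eq_true_eq,
        mem_bottoms]
      constructor
      · rintro (rfl | ⟨p, ⟨⟨-, -, h3, h4⟩, h5⟩, rfl⟩)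
        · exact ⟨by omega, by rw [hcj]⟩
        · exact ⟨h3, h4 ▸ h5⟩
      · rintro ⟨h1, h2⟩
        rcases hk.eq_or_lt with rfl | hlt
        · exact Or.inl rfl
        · have := (ih k hk).1
          exact Or.inr ⟨(k, v), ⟨⟨hlt, colLen_pos_iff.1 (by simp only; omega), h1, h2.symm⟩, rfl⟩,
            rfl⟩
    obtain ⟨ih1, ih2⟩ := ih k hk
    refine ⟨(removePath_le T j c k).trans ih1, fun i hi => ?_⟩
    rw [removePath]
    have htop : ∀ l < lam.1.colLen j - (m + 1), T l j < v := fun l hl =>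
      col_lt hT (by omega) (by omega)
    constructor
    · intro hlt
      have hic : i < c k := by split_ifs at hlt <;> omega
      obtain ⟨l, hl, hli⟩ := (ih2 i hi).1 hic
      refine ⟨l, ?_, hli⟩
      by_contra hcon
      -- The only value that column `j` loses in this step is `v`. In column `k` it can only be at
      -- the bottom, and there the path removes it.
      have hlv : l = lam.1.colLen j - m - 1 := by omega
      have hiv : T i k = v := by rw [← hli, hlv]
      obtain ⟨l', hl', hle'⟩ := (ih2 (c k - 1) (by omega)).1 (by omega)
      have h6 := hle l' hl'
      rw [hle', ← hiv] at h6
      have h7 := col_add_le hT (j := k) (show i ≤ c k - 1 by omega) (by omega)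
      have h8 : i = c k - 1 := by omega
      rw [if_pos (hmem.2 ⟨by omega, h8 ▸ hiv⟩)] at hlt
      omega
    · rintro ⟨l, hl, hli⟩
      have hic : i < c k := (ih2 i hi).2 ⟨l, by omega, hli⟩
      split_ifs with h
      · have h1 := (hmem.1 h).2
        have h2 := htop l hl
        have : i ≠ c k - 1 := by
          rintro rfl
          omega
        omega
      · exact hic

/-- When the path from `(i, j)` is formed, all boxes left to the right carry values from the top `i
+ 1` boxes of column `j`, so the recorded value is at most `T i j`. -/
theorem scan_le_of_nested {T : ℕ → ℕ → ℕ} (hT : T ∈ tableaux lam)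
    (hnest : ∀ j k, j ≤ k → ∀ i < lam.1.colLen k, ∃ l < lam.1.colLen j, T l j = T i k) :
    scan lam T ≤ T := by
  intro i j
  rcases lt_or_ge i (lam.1.colLen j) with hi | hi
  · have hc := iterate_removePath_self (lam := lam) T j (lam.1.colLen j - 1 - i) (by omega)
    have hinv := iterate_removePath_of_nested hT (hnest j) (lam.1.colLen j - 1 - i) (by omega)
    rw [scan_apply T hi]
    set c := (removePath lam T j)^[lam.1.colLen j - 1 - i] lam.1.colLen with hcdef
    have hcons := ewis_bottoms (lam := lam) T (c := c) (colLen_pos_iff.1 (show 0 < _ by omega))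
      (show 0 < c j by omega)
    obtain ⟨p, hp, he⟩ := exists_getLast?_eq (l := ewis (bottoms lam T j c)) (by simp [hcons])
    have hp' : p ∈ bottoms lam T j c := by
      rw [hcons] at hp
      rw [bottoms_eq_cons T (colLen_pos_iff.1 (by omega)) (by omega)]
      exact List.cons_subset_cons _ (ewisFrom_subset _ _) hp
    obtain ⟨h1, -, h3, h4⟩ := mem_bottoms.1 hp'
    obtain ⟨h5, h6⟩ := hinv p.1 h1
    obtain ⟨l, hl, hle⟩ := (h6 (c p.1 - 1) (by omega)).1 (by omega)
    rw [he, h4, ← hle]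
    have := col_add_le hT (j := j) (show l ≤ i by omega) hi
    change T l j ≤ T i j
    omega
  · rw [scan, if_neg fun h => absurd (YoungDiagram.mem_iff_lt_colLen.1 h) (not_lt.2 hi)]
    exact Nat.zero_le _

/-- If the value `z` in the column `j + 1` of `T` lies strictly between two consecutive values of
the column `j`, then the scanning tableau exceeds the smaller one at its place. -/
theorem lt_scan_of_gap {T : ℕ → ℕ → ℕ} (hT : T ∈ tableaux lam) {i j k : ℕ}
    (hi : i < lam.1.colLen j) (hk : k < lam.1.colLen (j + 1)) (hlt : T i j < T k (j + 1))
    (hgt : ∀ l, i < l → l < lam.1.colLen j → T k (j + 1) < T l j) :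
    T i j < scan lam T i j := by
  have hrow : ∀ l, 0 < lam.1.colLen l → l < lam.1.rowLen 0 := fun l => colLen_pos_iff.1
  have hc := fun m => iterate_removePath_self (lam := lam) T j m
  -- The paths starting below row `i` spare the box `(k, j + 1)`: they start with a value larger
  -- than the one in this box, so they skip it if it is at the bottom.
  have hstep : ∀ m ≤ lam.1.colLen j - 1 - i,
      k < (removePath lam T j)^[m] lam.1.colLen (j + 1) ∧
        (removePath lam T j)^[m] lam.1.colLen (j + 1) ≤ lam.1.colLen (j + 1) := by
    intro m hm
    induction m with
    | zero => exact ⟨hk, le_rfl⟩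
    | succ m ih =>
      obtain ⟨ih1, ih2⟩ := ih (by omega)
      have hcj := hc m (by omega)
      rw [Function.iterate_succ_apply']
      set c := (removePath lam T j)^[m] lam.1.colLen with hcdef
      refine ⟨?_, (removePath_le T j c _).trans ih2⟩
      rw [removePath]
      split_ifs with h
      · rw [ewis_bottoms T (hrow j (by omega)) (by omega), hcj,
          bottoms_eq_cons T (hrow (j + 1) (by omega)) (by omega), ewisFrom] at h
        have h1 := hgt (lam.1.colLen j - m - 1) (by omega) (by omega)
        by_contra hcon
        have h2 : c (j + 1) - 1 = k := by omega
        rw [h2, if_neg (not_le.2 h1), List.map_cons, List.mem_cons] at h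
        rcases h with h | h
        · omega
        · obtain ⟨p, hp, hpj⟩ := List.mem_map.1 h
          have := (mem_bottoms.1 (ewisFrom_subset _ _ hp)).1
          omega
      · exact ih1
  obtain ⟨h1, h2⟩ := hstep _ le_rfl
  have hcj := hc (lam.1.colLen j - 1 - i) (by omega)
  rw [scan_apply T hi]
  set c := (removePath lam T j)^[lam.1.colLen j - 1 - i] lam.1.colLen with hcdef
  -- The path from row `i` now meets a bottom value in column `j + 1` above `T i j`. It is taken,
  -- and the final value can only be larger or equal.
  have h3 : T k (j + 1) ≤ T (c (j + 1) - 1) (j + 1) := by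
    have := col_add_le hT (j := j + 1) (show k ≤ c (j + 1) - 1 by omega) (by omega)
    omega
  have h4 : c j - 1 = i := by omega
  rw [ewis_bottoms T (hrow j (by omega)) (by omega), h4,
    bottoms_eq_cons T (hrow (j + 1) (by omega)) (by omega), ewisFrom,
    if_pos (hlt.le.trans h3), List.getLast?_cons_cons]
  obtain ⟨p, hp, he⟩ := exists_getLast?_eq
    (List.cons_ne_nil (j + 1, T (c (j + 1) - 1) (j + 1))
      (ewisFrom (T (c (j + 1) - 1) (j + 1)) (bottoms lam T (j + 1 + 1) c)))
  rw [he]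
  rcases List.mem_cons.1 hp with rfl | hp
  · exact hlt.trans_le h3
  · exact hlt.trans_le (h3.trans (le_of_mem_ewisFrom _ _ _ hp))

theorem le_key_of_mem_demazureSet {π : Equiv.Perm (Fin n)} {T : ℕ → ℕ → ℕ}
    (hT : T ∈ demazureSet lam π) : T ≤ key lam π :=
  le_of_forall_shape hT.1 fun i j hi => (le_scan T hi).trans (hT.2 i j)

theorem key_mem_demazureSet (lam : NPartition n) (π : Equiv.Perm (Fin n)) :
    key lam π ∈ demazureSet lam π :=
  ⟨key_mem_tableaux lam π, scan_le_of_nested (key_mem_tableaux lam π)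
    fun _ _ hjk _ hi => key_nested lam π hjk hi⟩

/-- The tableau with the value `i` throughout the row `i`. -/
def superstandard (lam : NPartition n) : ℕ → ℕ → ℕ :=
  fun i j => if i < lam.1.colLen j then i else 0

theorem superstandard_mem_tableaux (lam : NPartition n) : superstandard lam ∈ tableaux lam := by
  refine mem_tableaux_iff.2 ⟨?_, ?_, ?_, ?_⟩
  · intro i j k hjk hi
    have := lam.1.colLen_anti j k hjk.le
    rw [superstandard, superstandard, if_pos hi, if_pos (by omega)]
  · intro i k j hik hk
    rwa [superstandard, superstandard, if_pos hk, if_pos (hik.trans hk)]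
  · intro i j h
    exact if_neg (not_lt.2 h)
  · intro i j h
    rw [superstandard, if_pos h]
    exact h.trans_le (colLen_le lam j)

theorem superstandard_le {T : ℕ → ℕ → ℕ} (hT : T ∈ tableaux lam) : superstandard lam ≤ T :=
  le_of_forall_shape (superstandard_mem_tableaux lam) fun i j hi => by
    rw [superstandard, if_pos hi]
    exact row_le_value hT hi

theorem superstandard_mem_demazureSet (lam : NPartition n) (π : Equiv.Perm (Fin n)) :
    superstandard lam ∈ demazureSet lam π := by
  refine ⟨superstandard_mem_tableaux lam, (scan_le_of_nested (superstandard_mem_tableaux lam)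
    fun j k hjk i hi => ?_).trans (superstandard_le (key_mem_tableaux lam π))⟩
  have := lam.1.colLen_anti j k hjk
  exact ⟨i, by omega, by rw [superstandard, superstandard, if_pos hi, if_pos (by omega)]⟩

theorem superstandard_mem_rowBoundSet {β : Fin n → Fin n} (hβ : IsUpper β) :
    superstandard lam ∈ rowBoundSet lam β :=
  mem_rowBoundSet_iff.2 ⟨superstandard_mem_tableaux lam, fun i j hi => by
    rw [superstandard, if_pos hi]
    exact hβ i⟩

end Scan

/-! ### Contents and generating functions -/

section GenFun

variable {n : ℕ} {lam : NPartition n}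

theorem coeff_genFun {A : Set (ℕ → ℕ → ℕ)} (hA : A ⊆ tableaux lam) (m : Fin n →₀ ℕ) :
    MvPolynomial.coeff m (genFun lam A hA) =
      ((((tableaux_finite lam).subset hA).toFinset.filter (fun T => content lam T = m)).card : ℤ) := by
  rw [genFun, MvPolynomial.coeff_sum]
  simp [MvPolynomial.coeff_monomial, Finset.sum_boole]

/-- Coefficients are cardinalities, so nothing cancels and the support of the polynomial is the set
of contents. -/
theorem exists_content_iff {A : Set (ℕ → ℕ → ℕ)} (hA : A ⊆ tableaux lam) (m : Fin n →₀ ℕ) :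
    MvPolynomial.coeff m (genFun lam A hA) ≠ 0 ↔ ∃ T ∈ A, content lam T = m := by
  rw [coeff_genFun, Nat.cast_ne_zero, Finset.card_ne_zero]
  simp [Finset.Nonempty]

theorem exists_content_eq {lam lam' : NPartition n} {A B : Set (ℕ → ℕ → ℕ)}
    {hA : A ⊆ tableaux lam} {hB : B ⊆ tableaux lam'} (h : genFun lam A hA = genFun lam' B hB)
    {T : ℕ → ℕ → ℕ} (hT : T ∈ A) : ∃ U ∈ B, content lam' U = content lam T := by
  rw [← exists_content_iff hB, ← h, exists_content_iff]
  exact ⟨T, hT, rfl⟩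

theorem eval_genFun {A : Set (ℕ → ℕ → ℕ)} (hA : A ⊆ tableaux lam) :
    MvPolynomial.eval (fun _ => 1) (genFun lam A hA) = (A.ncard : ℤ) := by
  rw [genFun, map_sum, Set.ncard_eq_toFinset_card A ((tableaux_finite lam).subset hA)]
  simp [MvPolynomial.eval_monomial]

theorem card_filter_eq_sum_content (T : ℕ → ℕ → ℕ) (K : Finset (Fin n)) :
    (lam.1.cells.filter (fun c => ∃ x ∈ K, T c.1 c.2 = (x : ℕ))).card =
      ∑ x ∈ K, content lam T x := by
  have : lam.1.cells.filter (fun c => ∃ x ∈ K, T c.1 c.2 = (x : ℕ)) =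
      K.biUnion (fun x => lam.1.cells.filter (fun c => T c.1 c.2 = (x : ℕ))) := by
    ext c
    simp only [Finset.mem_filter, Finset.mem_biUnion]
    tauto
  rw [this, Finset.card_biUnion]
  · rfl
  · intro x _ y _ hxy
    refine Finset.disjoint_filter.2 fun c _ h1 h2 => hxy (Fin.ext (h1.symm.trans h2))

theorem card_filter_eq_sum_columns (p : ℕ × ℕ → Prop) [DecidablePred p] :
    (lam.1.cells.filter p).card = ∑ j ∈ Finset.range (lam.1.rowLen 0),
      ((Finset.range (lam.1.colLen j)).filter (fun i => p (i, j))).card := by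
  rw [Finset.card_eq_sum_card_fiberwise (f := Prod.snd) (t := Finset.range (lam.1.rowLen 0))]
  · refine Finset.sum_congr rfl fun j _ => ?_
    rw [← Finset.card_image_of_injective
      ((Finset.range (lam.1.colLen j)).filter (fun i => p (i, j))) (Prod.mk_left_injective j)]
    refine congrArg Finset.card ?_
    ext ⟨i, k⟩
    simp only [Finset.mem_filter, Finset.mem_image, Finset.mem_range, Prod.mk.injEq,
      YoungDiagram.mem_cells, YoungDiagram.mem_iff_lt_colLen]
    constructor
    · rintro ⟨⟨h1, h2⟩, rfl⟩
      exact ⟨i, ⟨h1, h2⟩, rfl, rfl⟩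
    · rintro ⟨i, ⟨h1, h2⟩, rfl, rfl⟩
      exact ⟨⟨h1, h2⟩, rfl⟩
  · intro c hc
    have h := (YoungDiagram.mem_cells _).1 (Finset.mem_filter.1 (Finset.mem_coe.1 hc)).1
    have h' : c.1 < lam.1.colLen c.2 := YoungDiagram.mem_iff_lt_colLen.1 h
    exact Finset.mem_coe.2 (Finset.mem_range.2 (colLen_pos_iff.1 (by omega)))

/-- The number of boxes in the first `k` rows. -/
def rowSum (lam : NPartition n) (k : ℕ) : ℕ := (lam.1.cells.filter (fun c => c.1 < k)).card

theorem rowSum_succ (lam : NPartition n) (k : ℕ) :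
    rowSum lam (k + 1) = rowSum lam k + lam.1.rowLen k := by
  have h : lam.1.cells.filter (fun c => c.1 < k + 1) =
      lam.1.cells.filter (fun c => c.1 < k) ∪ lam.1.row k := by
    ext c
    simp only [Finset.mem_filter, Finset.mem_union, YoungDiagram.mem_row_iff,
      YoungDiagram.mem_cells, Nat.lt_succ_iff_lt_or_eq]
    tauto
  rw [rowSum, h, Finset.card_union_of_disjoint, YoungDiagram.rowLen_eq_card, rowSum]
  rw [Finset.disjoint_left]
  intro c h1 h2
  have h3 := (Finset.mem_filter.1 h1).2
  have h4 := (YoungDiagram.mem_row_iff.1 h2).2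
  omega

/-- A box in row `i` has value at least `i`, so values below `k` occur only in the first `k` rows.
The superstandard tableau fills those rows with such values, so it gives equality. -/
theorem sum_content_le_rowSum {T : ℕ → ℕ → ℕ} (hT : T ∈ tableaux lam) (k : ℕ) :
    ∑ x ∈ Finset.univ.filter (fun x : Fin n => (x : ℕ) < k), content lam T x ≤ rowSum lam k := by
  rw [← card_filter_eq_sum_content]
  refine Finset.card_le_card fun c hc => ?_
  obtain ⟨hc, x, hx, hxe⟩ := Finset.mem_filter.1 hc
  have h1 : c.1 < lam.1.colLen c.2 :=
    YoungDiagram.mem_iff_lt_colLen.1 ((YoungDiagram.mem_cells _).1 hc)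
  have h2 := row_le_value hT h1
  have h3 := (Finset.mem_filter.1 hx).2
  exact Finset.mem_filter.2 ⟨hc, by omega⟩

theorem sum_content_superstandard (lam : NPartition n) (k : ℕ) :
    ∑ x ∈ Finset.univ.filter (fun x : Fin n => (x : ℕ) < k), content lam (superstandard lam) x =
      rowSum lam k := by
  refine (sum_content_le_rowSum (superstandard_mem_tableaux lam) k).antisymm ?_
  rw [← card_filter_eq_sum_content]
  refine Finset.card_le_card fun c hc => ?_
  obtain ⟨hc, hk⟩ := Finset.mem_filter.1 hc
  have h1 : c.1 < lam.1.colLen c.2 :=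
    YoungDiagram.mem_iff_lt_colLen.1 ((YoungDiagram.mem_cells _).1 hc)
  refine Finset.mem_filter.2 ⟨hc, ⟨c.1, h1.trans_le (colLen_le lam _)⟩,
    Finset.mem_filter.2 ⟨Finset.mem_univ _, hk⟩, ?_⟩
  rw [superstandard, if_pos h1]

theorem rowSum_le_of_content_eq {lam lam' : NPartition n} {T : ℕ → ℕ → ℕ}
    (hT : T ∈ tableaux lam') (h : content lam' T = content lam (superstandard lam)) (k : ℕ) :
    rowSum lam k ≤ rowSum lam' k := by
  rw [← sum_content_superstandard, ← h]
  exact sum_content_le_rowSum hT k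

theorem eq_of_rowSum_eq {lam lam' : NPartition n} (h : ∀ k, rowSum lam k = rowSum lam' k) :
    lam = lam' := by
  refine Subtype.ext (SetLike.ext fun c => ?_)
  rw [← Prod.mk.eta (p := c), YoungDiagram.mem_iff_lt_rowLen, YoungDiagram.mem_iff_lt_rowLen]
  have h1 := rowSum_succ lam c.1
  have h2 := rowSum_succ lam' c.1
  rw [h, h] at h1
  rw [show lam.1.rowLen c.1 = lam'.1.rowLen c.1 by omega]

/-- A key is determined by its content. -/
theorem eq_key_of_content_eq {π : Equiv.Perm (Fin n)} {T : ℕ → ℕ → ℕ} (hT : T ∈ tableaux lam)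
    (h : content lam T = content lam (key lam π)) : T = key lam π := by
  have hmono : ∀ j i k, i < k → k < lam.1.colLen j → T i j < T k j :=
    fun j i k hik hk => col_lt hT hik hk
  funext i j
  rcases lt_or_ge i (lam.1.colLen j) with hi | hi
  swap
  · rw [(mem_tableaux_iff.1 hT).2.2.1 i j hi,
      (mem_tableaux_iff.1 (key_mem_tableaux lam π)).2.2.1 i j hi]
  set q := lam.1.colLen j with hq
  have hqn : q ≤ n := colLen_le lam j
  -- Counts, in each column, the boxes with values among the first `q` values of `π`. Strictness
  -- bounds the count by the minimum of `q` and the column length, and the key attains this bound in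
  -- every column.
  let cnt : (ℕ → ℕ → ℕ) → ℕ → Finset ℕ := fun U k => (Finset.range (lam.1.colLen k)).filter
    (fun i => ∃ x ∈ prefixSet π q, U i k = (x : ℕ))
  have hsum : ∀ U, ∑ x ∈ prefixSet π q, content lam U x =
      ∑ k ∈ Finset.range (lam.1.rowLen 0), (cnt U k).card := fun U => by
    rw [← card_filter_eq_sum_content, card_filter_eq_sum_columns]
  have hTle : ∀ k, (cnt T k).card ≤ min q (lam.1.colLen k) := by
    intro k
    refine le_min ?_ ?_
    · rw [← card_prefixSet π hqn, ← Finset.card_map Fin.valEmbedding]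
      refine Finset.card_le_card_of_injOn (fun i => T i k) ?_ ?_
      · intro i hi
        obtain ⟨x, hx, hxe⟩ := (Finset.mem_filter.1 (Finset.mem_coe.1 hi)).2
        exact Finset.mem_coe.2 (Finset.mem_map.2 ⟨x, hx, hxe.symm⟩)
      · exact (injOn_of_lt (hmono k)).mono (Finset.coe_subset.2 (Finset.filter_subset _ _))
    · exact (Finset.card_filter_le _ _).trans_eq (Finset.card_range _)
  have hYge : ∀ k, min q (lam.1.colLen k) ≤ (cnt (key lam π) k).card := by
    intro k
    rcases le_total (lam.1.colLen k) q with hk | hk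
    · rw [min_eq_right hk]
      refine (Finset.card_range _).symm.trans_le (Finset.card_le_card fun i hi => ?_)
      obtain ⟨x, hx, hxe⟩ := sortedPrefix_mem (π := π) (colLen_le lam k) (Finset.mem_range.1 hi)
      exact Finset.mem_filter.2 ⟨hi, x, prefixSet_mono π hk hx, by rw [key_apply, hxe]⟩
    · rw [min_eq_left hk, ← card_prefixSet π hqn, ← Finset.card_map Fin.valEmbedding]
      refine (Finset.card_le_card (t := (cnt (key lam π) k).image (fun i => key lam π i k))
        fun y hy => ?_).trans Finset.card_image_le
      obtain ⟨x, hx, rfl⟩ := Finset.mem_map.1 hy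
      obtain ⟨i, hi, hie⟩ := exists_sortedPrefix (colLen_le lam k) (prefixSet_mono π hk hx)
      rw [← key_apply] at hie
      exact Finset.mem_image.2 ⟨i, Finset.mem_filter.2 ⟨Finset.mem_range.2 hi, x, hx, hie⟩, hie⟩
  have heq : ∑ k ∈ Finset.range (lam.1.rowLen 0), (cnt T k).card =
      ∑ k ∈ Finset.range (lam.1.rowLen 0), (cnt (key lam π) k).card := by
    rw [← hsum, ← hsum, h]
  -- Equal contents give equal totals, so the bound is attained in every column. In column `j`, of
  -- length `q`, this determines the whole set of values.
  have hcol := (Finset.sum_eq_sum_iff_of_le fun k _ => (hTle k).trans (hYge k)).1 heq j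
    (Finset.mem_range.2 (colLen_pos_iff.1 (by omega)))
  have hfull : cnt T j = Finset.range q := by
    refine Finset.eq_of_subset_of_card_le (Finset.filter_subset _ _) ?_
    rw [Finset.card_range, hcol]
    exact (min_self q).symm.trans_le (hYge j)
  rw [key_apply]
  refine sortedPrefix_unique (π := π) hqn (f := fun i => T i j) (fun l hl => ?_)
    (fun a b hab hb => hmono j a b hab hb) hi
  have hl' : l ∈ cnt T j := hfull ▸ Finset.mem_range.2 hl
  obtain ⟨x, hx, hxe⟩ := (Finset.mem_filter.1 hl').2
  exact ⟨x, hx, hxe.symm⟩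

theorem shape_eq_of_genFun_eq {lam lam' : NPartition n} {β : Fin n → Fin n} (hβ : IsUpper β)
    {π : Equiv.Perm (Fin n)} (h : rowBoundSum lam β = demazurePoly lam' π) : lam = lam' := by
  obtain ⟨T, hT, hTc⟩ := exists_content_eq h (superstandard_mem_rowBoundSet hβ)
  obtain ⟨U, hU, hUc⟩ := exists_content_eq h.symm (superstandard_mem_demazureSet lam' π)
  exact eq_of_rowSum_eq fun k =>
    (rowSum_le_of_content_eq hT.1 hTc k).antisymm (rowSum_le_of_content_eq hU.1 hUc k)

/-- The monomial of the key occurs in the row bound sum too, and only the key itself can contribute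
it. -/
theorem key_mem_rowBoundSet {β : Fin n → Fin n} {π : Equiv.Perm (Fin n)}
    (h : rowBoundSum lam β = demazurePoly lam π) : key lam π ∈ rowBoundSet lam β := by
  obtain ⟨U, hU, hUc⟩ := exists_content_eq h.symm (key_mem_demazureSet lam π)
  exact eq_key_of_content_eq hU.1 hUc ▸ hU

theorem mem_rowBoundSet_of_le {β : Fin n → Fin n} {T U : ℕ → ℕ → ℕ} (hT : T ∈ tableaux lam)
    (hTU : T ≤ U) (hU : U ∈ rowBoundSet lam β) : T ∈ rowBoundSet lam β := by
  rw [mem_rowBoundSet_iff] at hU ⊢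
  exact ⟨hT, fun i j hi => (hTU i j).trans (hU.2 i j hi)⟩

/-- Demazure tableaux lie below the key, which is in the downward closed row bound set. Counting at
`x = (1, …, 1)` excludes strict inclusion. -/
theorem rowBoundSet_eq_demazureSet {β : Fin n → Fin n} {π : Equiv.Perm (Fin n)}
    (h : rowBoundSum lam β = demazurePoly lam π) : rowBoundSet lam β = demazureSet lam π := by
  have hsub : demazureSet lam π ⊆ rowBoundSet lam β := fun T hT =>
    mem_rowBoundSet_of_le hT.1 (le_key_of_mem_demazureSet hT) (key_mem_rowBoundSet h)
  have hcard : ((rowBoundSet lam β).ncard : ℤ) = (demazureSet lam π).ncard := by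
    rw [← eval_genFun (rowBoundSet_subset lam β), ← eval_genFun (demazureSet_subset lam π)]
    exact congrArg _ h
  exact (Set.eq_of_subset_of_ncard_le hsub (by exact_mod_cast hcard.le)
    ((tableaux_finite lam).subset (rowBoundSet_subset lam β))).symm

theorem rowBoundMax_eq_key {β : Fin n → Fin n} (hβ : IsUpper β) {π : Equiv.Perm (Fin n)}
    (hmem : key lam π ∈ rowBoundSet lam β) (h : rowBoundSet lam β = demazureSet lam π) :
    rowBoundMax lam β = key lam π := by
  have hl := rowBoundMax_isLeast lam β hβ
  refine le_antisymm (hl.2 ⟨key_mem_tableaux lam π, fun T hT => ?_⟩) (hl.1.2 hmem)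
  exact le_key_of_mem_demazureSet (h ▸ hT)

end GenFun

/-! ### Avoidance and gaplessness -/

section Avoidance

variable {n : ℕ} {lam : NPartition n}

theorem carrelEnd_le_colLen {b : Fin n} {j : ℕ} (hj : carrelStart (columnLengths lam) b <
    lam.1.colLen j) : carrelEnd (columnLengths lam) b ≤ lam.1.colLen j := by
  rcases (colLen_le lam j).eq_or_lt with he | hlt
  · rw [he]
    exact carrelEnd_le _ _
  · have hR := colLen_mem_columnLengths (lam := lam) (by omega) hlt
    by_contra hcon
    refine hcon (carrelEnd_le_of_mem hR ?_)
    by_contra hle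
    have := le_carrelStart hR (not_lt.1 hle)
    omega

/-- The number `rowLen q` counts the columns longer than `q`. The last of them and its right
neighbour have consecutive dividers as lengths. -/
theorem exists_adjacent_columns {b : Fin n} (h0 : 0 < carrelStart (columnLengths lam) b)
    (h1 : carrelEnd (columnLengths lam) b < n) :
    ∃ j, lam.1.colLen j = carrelEnd (columnLengths lam) b ∧
      lam.1.colLen (j + 1) = carrelStart (columnLengths lam) b := by
  set q := carrelStart (columnLengths lam) b with hq
  obtain ⟨-, -, l, hl⟩ := mem_columnLengths
    ((carrelStart_eq_or_mem (columnLengths lam) b).resolve_left h0.ne')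
  obtain ⟨-, -, l', hl'⟩ := mem_columnLengths
    ((carrelEnd_eq_or_mem (columnLengths lam) b).resolve_left h1.ne)
  have hqe : q < carrelEnd (columnLengths lam) b :=
    (carrelStart_le _ b).trans_lt (lt_carrelEnd _ b)
  have hiff : ∀ k, q < lam.1.colLen k ↔ k < lam.1.rowLen q := fun k => by
    rw [← YoungDiagram.mem_iff_lt_colLen, YoungDiagram.mem_iff_lt_rowLen]
  have h2 := (hiff l').1 (by omega)
  have h3 : ¬ l < lam.1.rowLen q := fun h => absurd ((hiff l).2 h) (by omega)
  have h4 : q < lam.1.colLen (lam.1.rowLen q - 1) := (hiff _).2 (by omega)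
  have h5 : ¬ q < lam.1.colLen (lam.1.rowLen q) := fun h => absurd ((hiff _).1 h) (lt_irrefl _)
  have h6 := lam.1.colLen_anti l' (lam.1.rowLen q - 1) (by omega)
  have h7 := lam.1.colLen_anti (lam.1.rowLen q) l (by omega)
  have h8 := carrelEnd_le_colLen h4
  refine ⟨lam.1.rowLen q - 1, by omega, ?_⟩
  rw [show lam.1.rowLen q - 1 + 1 = lam.1.rowLen q by omega]
  omega

/-- If `π` contains the pattern, then `D_λ(π)` is not the whole interval below the key. -/
theorem avoids312_of_demazureSet_eq {π : Equiv.Perm (Fin n)}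
    (h : ∀ T ∈ tableaux lam, T ≤ key lam π → T ∈ demazureSet lam π) :
    Avoids312 (columnLengths lam) π := by
  rintro ⟨a, b, c, ha, hc, hbc, hca⟩
  have hbs := carrelStart_le (columnLengths lam) b
  have hbe := lt_carrelEnd (columnLengths lam) b
  obtain ⟨j, hj, hj1⟩ := exists_adjacent_columns (lam := lam) (b := b) (by omega)
    (lt_of_le_of_lt hc c.isLt)
  set Y := key lam π with hY
  have hYT : Y ∈ tableaux lam := key_mem_tableaux lam π
  have hmemY : ∀ k (x : Fin n), (π.symm x : ℕ) < lam.1.colLen k →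
      ∃ i < lam.1.colLen k, Y i k = x := by
    intro k x hx
    obtain ⟨i, hi, hie⟩ := exists_sortedPrefix (colLen_le lam k) (mem_prefixSet.2 hx)
    exact ⟨i, hi, by rw [hY, key_apply, hie]⟩
  have hYmem : ∀ i k, i < lam.1.colLen k →
      ∃ x : Fin n, (π.symm x : ℕ) < lam.1.colLen k ∧ (x : ℕ) = Y i k := by
    intro i k hi
    obtain ⟨x, hx, hxe⟩ := sortedPrefix_mem (π := π) (colLen_le lam k) hi
    exact ⟨x, mem_prefixSet.1 hx, by rw [hY, key_apply, hxe]⟩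
  have hbc' : (π b : ℕ) < π c := hbc
  have hca' : (π c : ℕ) < π a := hca
  have hzne : ∀ k, lam.1.colLen k ≤ (c : ℕ) → ∀ i < lam.1.colLen k, Y i k ≠ π c := by
    intro k hk i hi he
    obtain ⟨x, hx, hxe⟩ := hYmem i k hi
    rw [he] at hxe
    rw [Fin.ext hxe, Equiv.symm_apply_apply] at hx
    omega
  -- Column `j + 1` contains `π a`, which exceeds `π c`. The first row `r` with an entry above `π c`
  -- is the place to modify.
  have hex : ∃ i, i < lam.1.colLen (j + 1) ∧ (π c : ℕ) < Y i (j + 1) := by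
    obtain ⟨i, hi, hie⟩ := hmemY (j + 1) (π a) (by rw [Equiv.symm_apply_apply]; omega)
    exact ⟨i, hi, by omega⟩
  classical
  obtain ⟨hr, hrz⟩ := Nat.find_spec hex
  have hrmin : ∀ i < Nat.find hex, Y i (j + 1) < π c := by
    intro i hi
    have h1 := Nat.find_min hex hi
    have h2 := hzne (j + 1) (by omega) i (hi.trans hr)
    by_contra hcon
    exact h1 ⟨hi.trans hr, by omega⟩
  set r := Nat.find hex with hrdef
  -- the first `r` values of the column `j + 1` and `π b` lie in the column `j` below `π c`
  have hYr : r < lam.1.colLen j ∧ Y r j < π c := by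
    have hnot : (π b : ℕ) ∉ (Finset.range r).image (fun i => Y i (j + 1)) := by
      intro hmem
      obtain ⟨i, hi, hie⟩ := Finset.mem_image.1 hmem
      obtain ⟨x, hx, hxe⟩ := hYmem i (j + 1) ((Finset.mem_range.1 hi).trans hr)
      rw [Fin.ext (hxe.trans hie), Equiv.symm_apply_apply] at hx
      omega
    refine lt_of_card_lt (f := fun i => Y i j)
      (S := insert (π b : ℕ) ((Finset.range r).image (fun i => Y i (j + 1))))
      (fun i k hik hk => col_lt hYT hik hk) ?_ ?_
    · intro s hs
      rcases Finset.mem_insert.1 hs with rfl | hs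
      · exact ⟨hbc', hmemY j (π b) (by rw [Equiv.symm_apply_apply]; omega)⟩
      · obtain ⟨i, hi, rfl⟩ := Finset.mem_image.1 hs
        have hi := Finset.mem_range.1 hi
        exact ⟨hrmin i hi, key_nested lam π (Nat.le_succ j) (hi.trans hr)⟩
    · rw [Finset.card_insert_of_notMem hnot, Finset.card_image_of_injOn, Finset.card_range]
      · omega
      · exact injOn_of_lt (f := fun i => Y i (j + 1))
          fun i k hik hk => col_lt hYT hik (hk.trans hr)
  -- Lowers one box of the key to `π c`, a value absent from columns `j` and `j + 1`. The row
  -- condition against column `j` is `hYr`, which rests on `π b < π c`.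
  set T : ℕ → ℕ → ℕ := fun i k => if i = r ∧ k = j + 1 then (π c : ℕ) else Y i k with hT
  have hTr : T r (j + 1) = π c := by simp [hT]
  have hTj : ∀ i k, k ≠ j + 1 → T i k = Y i k := fun i k hk => by simp [hT, hk]
  have hTi : ∀ i k, i ≠ r → T i k = Y i k := fun i k hi => by simp [hT, hi]
  have hTY : ∀ i k, T i k ≤ Y i k := by
    intro i k
    by_cases hik : i = r ∧ k = j + 1
    · obtain ⟨rfl, rfl⟩ := hik
      rw [hTr]
      exact hrz.le
    · simp [hT, hik]
  have hTT : T ∈ tableaux lam := by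
    refine mem_tableaux_iff.2 ⟨?_, ?_, ?_, ?_⟩
    · intro i k l hkl hi
      by_cases hil : i = r ∧ l = j + 1
      · obtain ⟨rfl, rfl⟩ := hil
        rw [hTr, hTj _ k hkl.ne]
        exact (row_le hYT (Nat.lt_succ_iff.1 hkl) hYr.1).trans hYr.2.le
      · have : T i l = Y i l := by simp [hT, hil]
        rw [this]
        exact (hTY i k).trans (row_le hYT hkl.le hi)
    · intro i l k hil hl
      have hlt := col_lt hYT hil hl
      by_cases hlk : l = r ∧ k = j + 1
      · obtain ⟨rfl, rfl⟩ := hlk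
        rw [hTr, hTi i _ hil.ne]
        exact hrmin i hil
      · have : T l k = Y l k := by simp [hT, hlk]
        rw [this]
        exact (hTY i k).trans_lt hlt
    · intro i k hik
      have := (mem_tableaux_iff.1 hYT).2.2.1 i k hik
      have := hTY i k
      omega
    · intro i k hik
      exact (hTY i k).trans_lt ((mem_tableaux_iff.1 hYT).2.2.2 i k hik)
  -- the last value of the column `j` below `π c`
  set s := Nat.findGreatest (fun i => i < lam.1.colLen j ∧ Y i j < π c) (lam.1.colLen j) with hs
  obtain ⟨hsj, hsz⟩ : s < lam.1.colLen j ∧ Y s j < π c :=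
    Nat.findGreatest_spec (P := fun i => i < lam.1.colLen j ∧ Y i j < π c) hYr.1.le hYr
  have hjne : j ≠ j + 1 := (Nat.lt_succ_self j).ne
  -- The new value `π c` falls strictly between the entry of column `j` in row `s` and all those
  -- below it, so the scan exceeds the key at `(s, j)`.
  have hscan := lt_scan_of_gap hTT hsj hr (by rwa [hTr, hTj _ _ hjne]) (by
    intro l hl1 hl2
    rw [hTr, hTj _ _ hjne]
    have h1 := Nat.findGreatest_is_greatest hl1 hl2.le
    have h2 := hzne j (by omega) l hl2
    by_contra hcon
    exact h1 ⟨hl2, by omega⟩)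
  have hle := (h T hTT hTY).2 s j
  rw [hTj _ _ hjne] at hscan
  exact absurd hscan (not_lt.2 hle)

/-- The rank tuple of a pattern avoiding permutation has no gaps. -/
theorem isGapless_rankTuple {R : Finset ℕ} {π : Equiv.Perm (Fin n)}
    (hupper : IsUpper (rankTuple R π)) (hinc : IsIncreasing R (rankTuple R π))
    (hav : Avoids312 R π) : IsGapless R (rankTuple R π) := by
  refine ⟨hupper, hinc, ?_⟩
  intro a b hab hb hlt s hs
  have hlt' : (rankTuple R π b : ℕ) < rankTuple R π a := hlt
  have hae : carrelEnd R a = b := by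
    have h1 := carrelEnd_le_of_mem hb (show (a : ℕ) < b by omega)
    have h2 := lt_carrelEnd R a
    omega
  have hbs : carrelStart R b = b := (carrelStart_le R b).antisymm (le_carrelStart hb le_rfl)
  have hbe := lt_carrelEnd R b
  have hen := carrelEnd_le R b
  set e := carrelEnd R b with he
  have hγa := rankTuple_eq_sortedPrefix R π a
  have hγb := rankTuple_eq_sortedPrefix R π b
  rw [hae] at hγa
  rw [← he] at hγb
  have hun := (rankTuple R π a).isLt
  -- Here `u` is the largest of the first `b` values of `π`, and `v` is the element of index `b`,
  -- counted from `0`, in the sorted list of the first `e` values.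
  obtain ⟨u, hu⟩ : ∃ u, u = (rankTuple R π a : ℕ) := ⟨_, rfl⟩
  obtain ⟨v, hv⟩ : ∃ v, v = (rankTuple R π b : ℕ) := ⟨_, rfl⟩
  rw [← hu] at hγa hlt' hs hun ⊢
  rw [← hv] at hγb hlt' hs
  have hmono : ∀ i k, i < k → k < e → sortedPrefix π e i < sortedPrefix π e k :=
    fun _ _ => sortedPrefix_lt hen
  obtain ⟨xa, hxa, hxae⟩ := sortedPrefix_mem (π := π) b.isLt.le (show (a : ℕ) < b by omega)
  -- some position of the carrel of `b` has a value at most `v`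
  obtain ⟨p, hp1, hp2, hp3⟩ : ∃ p : Fin n, (b : ℕ) ≤ p ∧ (p : ℕ) < e ∧ (π p : ℕ) ≤ v := by
    by_contra hcon
    push Not at hcon
    -- Among the first `e` values, `b + 1` are at most `v`, so they cannot all be among the first
    -- `b` values.
    have := lt_of_card_lt (f := sortedPrefix π b) (q := b) (i := b) (z := v + 1)
      (S := (Finset.range (b + 1)).image (sortedPrefix π e))
      (fun _ _ => sortedPrefix_lt b.isLt.le) ?_ ?_
    · exact absurd this.1 (lt_irrefl _)
    · intro t ht
      obtain ⟨i, hi, rfl⟩ := Finset.mem_image.1 ht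
      have hi := Finset.mem_range.1 hi
      have hiv : sortedPrefix π e i ≤ v := by
        rcases (Nat.lt_succ_iff.1 hi).eq_or_lt with rfl | h
        · exact hγb.ge
        · exact (hmono i b h hbe).le.trans hγb.ge
      obtain ⟨x, hx, hxe⟩ := sortedPrefix_mem (π := π) hen (show i < e by omega)
      refine ⟨by omega, hxe ▸ exists_sortedPrefix b.isLt.le (mem_prefixSet.2 ?_)⟩
      by_contra hxb
      have := hcon (π.symm x) (not_lt.1 hxb) (mem_prefixSet.1 hx)
      rw [Equiv.apply_symm_apply] at this
      omega
    · rw [Finset.card_image_of_injOn, Finset.card_range]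
      · omega
      · exact (injOn_of_lt hmono).mono (by
          intro i hi
          simp only [Finset.coe_range, Set.mem_Iio] at hi ⊢
          omega)
  have hpe : carrelEnd R p = e :=
    ((sameCarrel_iff (show b ≤ p from hp1)).2 hp2).carrelEnd_eq.symm
  have hps : carrelStart R p = b :=
    ((sameCarrel_iff (show b ≤ p from hp1)).2 hp2).carrelStart_eq.symm.trans hbs
  -- A value `w` strictly between `v` and `u` occurring only at or after position `e` would complete
  -- a 312 pattern with `u` before the carrel and `π p ≤ v` inside it.
  have hint : ∀ w, v < w → w ≤ u → ∃ k < e, sortedPrefix π e k = w := by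
    intro w hw1 hw2
    have hwn : w < n := by omega
    refine exists_sortedPrefix (x := ⟨w, hwn⟩) hen (mem_prefixSet.2 ?_)
    by_contra hcon
    rcases hw2.eq_or_lt with rfl | hwu
    · have hxw : xa = ⟨w, hwn⟩ := Fin.ext (by simp only; omega)
      have := mem_prefixSet.1 (hxw ▸ hxa)
      omega
    · refine hav ⟨π.symm xa, p, π.symm ⟨w, hwn⟩, ?_, ?_, ?_, ?_⟩
      · rw [hps]
        exact mem_prefixSet.1 hxa
      · rw [hpe]
        exact not_lt.1 hcon
      · rw [Equiv.apply_symm_apply]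
        exact Fin.lt_def.2 (by simp only; omega)
      · rw [Equiv.apply_symm_apply, Equiv.apply_symm_apply]
        exact Fin.lt_def.2 (by simp only; omega)
  -- All integers from `v` to `u` occur in the sorted list, with `v` at index `b`, so they occupy
  -- consecutive places from there on.
  have hrun : ∀ t : ℕ, v + t ≤ u → b + t < e ∧ sortedPrefix π e (b + t) = v + t := by
    intro t
    induction t with
    | zero => exact fun _ => ⟨hbe, hγb.symm⟩
    | succ t ih =>
      intro ht
      obtain ⟨ih1, ih2⟩ := ih (by omega)
      obtain ⟨k, hk, hke⟩ := hint (v + (t + 1)) (by omega) ht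
      have hbk : b + t < k := by
        by_contra hcon
        rcases (not_lt.1 hcon).eq_or_lt with rfl | h
        · omega
        · have := hmono k (b + t) h ih1
          omega
      have h1 := hmono (b + t) (b + (t + 1)) (by omega) (by omega)
      refine ⟨by omega, ?_⟩
      rcases (show (b : ℕ) + (t + 1) ≤ k by omega).eq_or_lt with h | h
      · rw [h, hke]
      · have := hmono _ _ h hk
        omega
  refine ⟨?_, fun c hbc hcs => ?_⟩
  · have := (hrun (u - v) (by omega)).1
    omega
  · have hbc' : (b : ℕ) ≤ c := hbc
    obtain ⟨h1, h2⟩ := hrun (c - b) (by omega)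
    have hce : carrelEnd R c = e := ((sameCarrel_iff hbc).2 (by omega)).carrelEnd_eq.symm
    rw [rankTuple_eq_sortedPrefix, hce]
    rw [show (b : ℕ) + (c - b) = c by omega] at h2
    omega

end Avoidance

end RowBoundSums

open RowBoundSums

/-! ### Assembly of the main theorem -/

theorem mainTheorem4 (n : ℕ) (hn : 1 ≤ n) (lam lam' : NPartition n)
    (β : Fin n → Fin n) (hβ : IsUpper β)
    (π : Equiv.Perm (Fin n)) (hπ : IsRPermutation (columnLengths lam') π)
    (h : rowBoundSum lam β = demazurePoly lam' π) :
    lam = lam' ∧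
    rowBoundMax lam β = key lam' π ∧
    core (columnLengths lam) β = rankTuple (columnLengths lam) π ∧
    Avoids312 (columnLengths lam) π ∧
    IsGapless (columnLengths lam) (core (columnLengths lam) β) ∧
    IsGaplessCore (columnLengths lam) β ∧
    rowBoundSet lam β = demazureSet lam' π ∧
    IsUpper (floorMap (columnLengths lam) (core (columnLengths lam) β)) ∧
    IsFlag (floorMap (columnLengths lam) (core (columnLengths lam) β)) ∧
    rowBoundSet lam β =
      rowBoundSet lam (floorMap (columnLengths lam) (core (columnLengths lam) β)) ∧
    rowBoundSum lam β =
      rowBoundSum lam (floorMap (columnLengths lam) (core (columnLengths lam) β)) := by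
  obtain rfl := shape_eq_of_genFun_eq hβ h
  have hset := rowBoundSet_eq_demazureSet h
  have hmem := key_mem_rowBoundSet h
  have hmax := rowBoundMax_eq_key hβ hmem hset
  have hcore := core_eq_rankTuple hβ hmax
  have hup := isUpper_core (R := columnLengths lam) hβ
  have hmono := excessMono_core (R := columnLengths lam) hβ
  -- The Demazure set is now a downward closed set containing the key, hence the whole interval
  -- below it.
  have hav : Avoids312 (columnLengths lam) π := avoids312_of_demazureSet_eq fun T hT hle =>
    hset ▸ mem_rowBoundSet_of_le hT hle hmem
  have hgap : IsGapless (columnLengths lam) (core (columnLengths lam) β) := by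
    have hinc := hmono.isIncreasing
    -- That the tuple is upper and increasing is known on the core side and carried over to the rank
    -- tuple.
    rw [hcore] at hup hinc ⊢
    exact isGapless_rankTuple hup hinc hav
  have hfloor : rowBoundSet lam β =
      rowBoundSet lam (floorMap (columnLengths lam) (core (columnLengths lam) β)) := by
    rw [rowBoundSet_floorMap hup hmono, rowBoundSet_core hβ]
  refine ⟨rfl, hmax, hcore, hav, hgap, ⟨hβ, hgap⟩, hset, isUpper_floorMap hup hmono,
    hgap.isFlag_floorMap hmono, hfloor, ?_⟩
  simp only [rowBoundSum, genFun, hfloor]
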